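/- Let $n\ge 3$ be an integer and $[n]=\{1,\dots,n\}$. A maximal $(2,3)$-antichain on $[n]$ is a family $\mathcal A$ of $2$-subsets and $3$-subsets of $[n]$ such that no member of $\mathcal A$ is contained in another one, and every $X\subseteq[n]$ with $X\notin\mathcal A$ satisfies $X\subseteq A$ or $A\subseteq X$ for some $A\in\mathcal A$. It is $r$-regular if every point of $[n]$ lies in exactly $r$ members of $\mathcal A$. The graph of $\mathcal A$ has vertex set $[n]$, and its edges are the $2$-subsets of $[n]$ that are not in $\mathcal A$. A generalized quadrangle $GQ(s,t)$, where $s,t\ge 1$, is a nonempty set of points and a nonempty set of lines with an incidence relation such that every point is on exactly $t+1$ lines, every line has exactly $s+1$ points, two distinct points are on at most one common line, two distinct lines have at most one common point, and for every point $p$ not on a line $\ell$ there is a unique pair $(q,m)$ of a point $q$ and a line $m$ with $p$ on $m$, $q$ on $m$ and $q$ on $\ell$. Its collinearity graph has the points as vertices, two distinct points being adjacent if they lie on a common line. 1. There exists a $\frac{5n-9}{6}$-regular maximal $(2,3)$-antichain on $[n]$ if and only if $n\in\{3,9,15,27\}$. 2. Any two $\frac{5n-9}{6}$-regular maximal $(2,3)$-antichains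 on $[n]$ are isomorphic, i.e. some permutation of $[n]$ carries one onto the other. 3. In the graph of every $\frac{5n-9}{6}$-regular maximal $(2,3)$-antichain on $[n]$, every edge lies in exactly one triangle, and the number of edges is $\frac{n(n+3)}{6}$. 4. A graph on the vertex set $[n]$ has exactly $\frac{n(n+3)}{6}$ edges and every edge in exactly one triangle if and only if either $n=3$ and the graph is the triangle, or $t=\frac{n-3}{6}$ is a positive integer and the graph is isomorphic to the collinearity graph of a generalized quadrangle $GQ(2,t)$. -/

import Mathlib

/-- `𝒜` is a maximal `(2,3)`-antichain on the point set `α`: it consists of 2-subsets and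
3-subsets of `α`, it is an antichain, and every subset of `α` outside `𝒜` is comparable to
some member of `𝒜`. -/
structure IsMaximalTwoThreeAntichain {α : Type*} (𝒜 : Finset (Finset α)) : Prop where
  card_mem : ∀ A ∈ 𝒜, A.card = 2 ∨ A.card = 3
  antichain : IsAntichain (· ⊆ ·) (𝒜 : Set (Finset α))
  maximal : ∀ X : Finset α, X ∉ 𝒜 → ∃ A ∈ 𝒜, X ⊆ A ∨ A ⊆ X

/-- Every point is contained in exactly `r` members of `𝒜`. -/
def IsRegularFamily {α : Type*} [DecidableEq α] (𝒜 : Finset (Finset α)) (r : ℕ) : Prop :=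
  ∀ x : α, (𝒜.filter (fun A => x ∈ A)).card = r

/-- A maximal `(2,3)`-antichain on `n` points which is `(5n-9)/6`-regular
(in particular, `(5n-9)/6` is a nonnegative integer). -/
def IsExtremalTwoThreeAntichain {n : ℕ} (𝒜 : Finset (Finset (Fin n))) : Prop :=
  IsMaximalTwoThreeAntichain 𝒜 ∧
    ∃ r : ℕ, (r : ℚ) = (5 * (n : ℚ) - 9) / 6 ∧ IsRegularFamily 𝒜 r

/-- Two families on the same point set are isomorphic: some permutation of the points carries
one onto the other. -/
def FamilyIsomorphic {α : Type*} (𝒜 ℬ : Finset (Finset α)) : Prop :=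
  ∃ σ : Equiv.Perm α, ∀ A : Finset α, A ∈ 𝒜 ↔ A.map σ.toEmbedding ∈ ℬ

/-- The graph associated with a `(2,3)`-antichain: its edges are the 2-subsets not in `𝒜`. -/
def antichainGraph {α : Type*} [DecidableEq α] (𝒜 : Finset (Finset α)) : SimpleGraph α where
  Adj x y := x ≠ y ∧ ({x, y} : Finset α) ∉ 𝒜
  symm := ⟨fun x y h => ⟨h.1.symm, by rw [Finset.pair_comm]; exact h.2⟩⟩
  loopless := ⟨fun _ h => h.1 rfl⟩

/-- Every edge lies in exactly one triangle: its ends have exactly one common neighbour. -/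
def EdgesInUniqueTriangle {V : Type*} (G : SimpleGraph V) : Prop :=
  ∀ x y : V, G.Adj x y → ∃! z : V, G.Adj x z ∧ G.Adj y z

/-- The incidence structure `(P, L, I)` is a generalized quadrangle `GQ(s,t)`. -/
structure IsGeneralizedQuadrangle {P L : Type*} (I : P → L → Prop) (s t : ℕ) : Prop where
  nonempty_points : Nonempty P
  nonempty_lines : Nonempty L
  one_le_s : 1 ≤ s
  one_le_t : 1 ≤ t
  lines_through : ∀ p : P, {l : L | I p l}.ncard = t + 1
  points_on : ∀ l : L, {p : P | I p l}.ncard = s + 1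
  line_unique : ∀ p q : P, p ≠ q → ∀ l m : L, I p l → I q l → I p m → I q m → l = m
  point_unique : ∀ l m : L, l ≠ m → ∀ p q : P, I p l → I p m → I q l → I q m → p = q
  project : ∀ (p : P) (l : L), ¬ I p l → ∃! qm : P × L, I p qm.2 ∧ I qm.1 qm.2 ∧ I qm.1 l

/-- The collinearity graph: distinct points are adjacent when some line contains both. -/
def collinearityGraph {P L : Type*} (I : P → L → Prop) : SimpleGraph P where
  Adj x y := x ≠ y ∧ ∃ l : L, I x l ∧ I y l
  symm := ⟨fun _ _ h => ⟨h.1.symm, h.2.imp fun _ hl => ⟨hl.2, hl.1⟩⟩⟩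
  loopless := ⟨fun _ h => h.1 rfl⟩

open Finset

/-! A maximal `(2,3)`-antichain is a graph in which every edge lies in a triangle: its members are
the nonadjacent pairs and the triangles. A vertex of degree `d` in `T` triangles lies in `n - 1 - d
+ T` members, so extremal regularity reads `6d = 6T + n + 3` at every vertex. Inclusion–exclusion
for the three neighbourhoods of a triangle bounds its degree sum, and together with the local
equation this leaves no room for a second triangle on an edge (`unique_triangle_of_local_equation`).
All degrees are then `(n+3)/3`, so `n = 6t+3` and the degree is `2t+2`. If the number of edges is
prescribed instead, the same bound forces the degrees to have zero variance
(`IsQuadrangleGraph.of_card_edges`). Equality in the bound makes every triangle dominate all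
vertices, which is the projection axiom of a `GQ(2,t)` with the triangles as lines.

For the classification, fix nonadjacent `x`, `y` with common neighbours `z i`. There are `3t-2` far
points, adjacent to neither, and each has a trace, the set of `i` with `z i` adjacent to it. Double
counting fixes the first two moments of the trace sizes. Cauchy–Schwarz gives `t ≤ 4`, and since the
sizes `2` and `t` never occur, `t = 3` is impossible. For `t = 1, 2, 4` a quadratic with vanishing
sum determines the sizes; traces separate far points, and all admissible traces occur. Every
adjacency can then be read off from names (`IsQuadrangleGraph.exists_coordinates`), which gives
uniqueness. Existence comes from explicit models. -/

theorem card_add_card_add_card_le_card_union {V : Type*} [DecidableEq V] (A B C : Finset V) :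
    #A + #B + #C ≤ #(A ∪ B ∪ C) + #(A ∩ B) + #(B ∩ C) + #(A ∩ C) := by
  have h1 := card_union_add_card_inter A B
  have h2 := card_union_add_card_inter (A ∪ B) C
  have h3 : #((A ∪ B) ∩ C) ≤ #(A ∩ C) + #(B ∩ C) := by
    rw [union_inter_distrib_right]; exact card_union_le _ _
  omega

/-! ### Counting triangles, and from graphs to antichains -/

section Graph
variable {V : Type*} [Fintype V] [DecidableEq V] (G : SimpleGraph V) [DecidableRel G.Adj]

theorem degree_sum_le (x y z : V) :
    G.degree x + G.degree y + G.degree z ≤ Fintype.card V +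
      #(G.neighborFinset x ∩ G.neighborFinset y) + #(G.neighborFinset y ∩ G.neighborFinset z) +
      #(G.neighborFinset x ∩ G.neighborFinset z) := by
  have h := card_add_card_add_card_le_card_union
    (G.neighborFinset x) (G.neighborFinset y) (G.neighborFinset z)
  have h' := card_le_univ (G.neighborFinset x ∪ G.neighborFinset y ∪ G.neighborFinset z)
  simp only [G.card_neighborFinset_eq_degree] at h
  omega

/-- The equality case of the union bound: the three neighbourhoods cover everything. -/
theorem adj_of_card_le_degree_sum {x y z : V}
    (h : Fintype.card V + #(G.neighborFinset x ∩ G.neighborFinset y) +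
      #(G.neighborFinset y ∩ G.neighborFinset z) + #(G.neighborFinset x ∩ G.neighborFinset z) ≤
      G.degree x + G.degree y + G.degree z) (w : V) : G.Adj x w ∨ G.Adj y w ∨ G.Adj z w := by
  have h1 := card_add_card_add_card_le_card_union
    (G.neighborFinset x) (G.neighborFinset y) (G.neighborFinset z)
  simp only [G.card_neighborFinset_eq_degree] at h1
  have h2 : G.neighborFinset x ∪ G.neighborFinset y ∪ G.neighborFinset z = univ := by
    apply eq_univ_of_card
    have := card_le_univ (G.neighborFinset x ∪ G.neighborFinset y ∪ G.neighborFinset z)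
    omega
  have h3 := h2 ▸ mem_univ w
  simpa [or_assoc] using h3

variable {G} in
theorem card_common_eq_one (h : EdgesInUniqueTriangle G) {x y : V} (hxy : G.Adj x y) :
    #(G.neighborFinset x ∩ G.neighborFinset y) = 1 := by
  obtain ⟨z, hz, hu⟩ := h x y hxy
  rw [card_eq_one]
  refine ⟨z, ?_⟩
  ext w
  simp only [mem_inter, SimpleGraph.mem_neighborFinset, mem_singleton]
  exact ⟨fun hw => hu w hw, fun hw => hw ▸ hz⟩

variable {G} in
theorem edgesInUniqueTriangle_of_card
    (h : ∀ x y, G.Adj x y → #(G.neighborFinset x ∩ G.neighborFinset y) = 1) :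
    EdgesInUniqueTriangle G := by
  intro x y hxy
  obtain ⟨z, hz⟩ := card_eq_one.1 (h x y hxy)
  have hz' : ∀ w, (G.Adj x w ∧ G.Adj y w) ↔ w = z := fun w => by
    simpa using congrArg (w ∈ ·) hz
  exact ⟨z, (hz' z).2 rfl, fun w hw => (hz' w).1 hw⟩

/-- The number of triangles on an edge is the number of common neighbours of its ends. -/
theorem card_triangles_on_edge {v u : V} (h : G.Adj v u) :
    #{T ∈ G.cliqueFinset 3 | v ∈ T ∧ u ∈ T} = #(G.neighborFinset v ∩ G.neighborFinset u) := by
  symm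
  apply card_bij (fun z _ => {v, u, z})
  · intro z hz
    simp only [mem_inter, SimpleGraph.mem_neighborFinset] at hz
    simp [SimpleGraph.mem_cliqueFinset_iff, SimpleGraph.is3Clique_triple_iff, h, hz.1, hz.2]
  · intro z hz w hw e
    simp only [mem_inter, SimpleGraph.mem_neighborFinset] at hz hw
    have : z ∈ ({v, u, w} : Finset V) := by rw [← e]; simp
    simp only [mem_insert, mem_singleton] at this
    rcases this with rfl | rfl | rfl
    · exact absurd hz.1 (G.irrefl)
    · exact absurd hz.2 (G.irrefl)
    · rfl
  · intro T hT
    simp only [mem_filter, SimpleGraph.mem_cliqueFinset_iff] at hT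
    obtain ⟨hT, hv, hu⟩ := hT
    have hc : #((T.erase v).erase u) = 1 := by
      rw [card_erase_of_mem (mem_erase.2 ⟨h.ne', hu⟩), card_erase_of_mem hv, hT.card_eq]
    obtain ⟨z, hz⟩ := card_eq_one.1 hc
    have hT' : T = {v, u, z} := by
      rw [← hz, insert_erase (mem_erase.2 ⟨h.ne', hu⟩), insert_erase hv]
    subst hT'
    rw [SimpleGraph.is3Clique_triple_iff] at hT
    exact ⟨z, by simp [hT.2.1, hT.2.2], rfl⟩

/-- Double counting of pairs `(u, T)`: each triangle at `v` has two further vertices. -/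
theorem two_mul_card_triangles (v : V) :
    2 * #{T ∈ G.cliqueFinset 3 | v ∈ T} =
      ∑ u ∈ G.neighborFinset v, #(G.neighborFinset v ∩ G.neighborFinset u) := by
  have h := sum_card_bipartiteAbove_eq_sum_card_bipartiteBelow
    (s := G.neighborFinset v) (t := {T ∈ G.cliqueFinset 3 | v ∈ T}) (fun u T => u ∈ T)
  have h1 : ∑ u ∈ G.neighborFinset v,
      #(bipartiteAbove (fun u T => u ∈ T) {T ∈ G.cliqueFinset 3 | v ∈ T} u) =
      ∑ u ∈ G.neighborFinset v, #(G.neighborFinset v ∩ G.neighborFinset u) := by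
    refine sum_congr rfl fun u hu => ?_
    rw [← card_triangles_on_edge G (by simpa using hu), bipartiteAbove, filter_filter]
  have h2 : ∀ T ∈ ({T ∈ G.cliqueFinset 3 | v ∈ T} : Finset (Finset V)),
      #(bipartiteBelow (fun u T => u ∈ T) (G.neighborFinset v) T) = 2 := by
    intro T hT
    simp only [mem_filter, SimpleGraph.mem_cliqueFinset_iff] at hT
    have : bipartiteBelow (fun u T => u ∈ T) (G.neighborFinset v) T = T.erase v := by
      ext u
      simp only [bipartiteBelow, mem_filter, SimpleGraph.mem_neighborFinset, mem_erase]
      exact ⟨fun h => ⟨h.1.ne', h.2⟩, fun h => ⟨hT.1.isClique hT.2 h.2 h.1.symm, h.2⟩⟩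
    rw [this, card_erase_of_mem hT.2, hT.1.card_eq]
  rw [h1, sum_congr rfl h2, sum_const, smul_eq_mul] at h
  rw [h, mul_comm]

theorem card_pairs_through (v : V) : #{A ∈ G.cliqueFinset 2 | v ∈ A} = G.degree v := by
  rw [← G.card_neighborFinset_eq_degree]
  symm
  apply card_bij (fun z _ => {v, z})
  · intro z hz
    simp only [SimpleGraph.mem_neighborFinset] at hz
    simp [SimpleGraph.mem_cliqueFinset_iff, SimpleGraph.isNClique_iff, hz, hz.ne]
  · intro z hz w hw e
    simp only [SimpleGraph.mem_neighborFinset] at hz hw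
    have : z ∈ ({v, w} : Finset V) := by rw [← e]; simp
    simp only [mem_insert, mem_singleton] at this
    exact this.resolve_left hz.ne'
  · intro A hA
    simp only [mem_filter, SimpleGraph.mem_cliqueFinset_iff] at hA
    obtain ⟨z, hz⟩ := card_eq_one.1 (by rw [card_erase_of_mem hA.2, hA.1.card_eq] :
      #(A.erase v) = 1)
    have hzA : z ∈ A.erase v := hz ▸ mem_singleton_self z
    refine ⟨z, ?_, ?_⟩
    · simpa using hA.1.isClique hA.2 (mem_of_mem_erase hzA) (ne_of_mem_erase hzA).symm
    · rw [← hz, insert_erase hA.2]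

/-- The family of all nonadjacent pairs and all triangles of a graph. -/
def nonedgesAndTriangles : Finset (Finset V) := Gᶜ.cliqueFinset 2 ∪ G.cliqueFinset 3

variable {G}

theorem pair_mem_nonedgesAndTriangles {x y : V} :
    {x, y} ∈ nonedgesAndTriangles G ↔ x ≠ y ∧ ¬ G.Adj x y := by
  simp only [nonedgesAndTriangles, mem_union, SimpleGraph.mem_cliqueFinset_iff,
    SimpleGraph.isNClique_iff, coe_insert, coe_singleton]
  constructor
  · rintro (⟨h, hc⟩ | ⟨-, hc⟩)
    · have hne : x ≠ y := by rintro rfl; simp at hc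
      exact ⟨hne, (h (by simp) (by simp) hne).2⟩
    · have := card_le_two (a := x) (b := y); omega
  · rintro ⟨hne, h⟩
    left
    exact ⟨SimpleGraph.isClique_pair.2 fun _ => ⟨hne, h⟩, card_pair hne⟩

theorem triple_mem_nonedgesAndTriangles {A : Finset V} (hA : #A = 3) :
    A ∈ nonedgesAndTriangles G ↔ G.IsClique A := by
  simp [nonedgesAndTriangles, SimpleGraph.mem_cliqueFinset_iff, SimpleGraph.isNClique_iff, hA]

theorem card_nonedgesAndTriangles_through (v : V) :
    #{A ∈ nonedgesAndTriangles G | v ∈ A} + G.degree v + 1 =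
      Fintype.card V + #{T ∈ G.cliqueFinset 3 | v ∈ T} := by
  have hd : Disjoint {A ∈ Gᶜ.cliqueFinset 2 | v ∈ A} {T ∈ G.cliqueFinset 3 | v ∈ T} := by
    rw [disjoint_left]
    intro A h1 h2
    simp only [mem_filter, SimpleGraph.mem_cliqueFinset_iff] at h1 h2
    have := h1.1.card_eq; have := h2.1.card_eq; omega
  rw [nonedgesAndTriangles, filter_union, card_union_of_disjoint hd, card_pairs_through,
    G.degree_compl]
  have := G.degree_lt_card_verts v
  omega

/-- A non-clique contains a nonedge and a clique of size at least three contains a triangle. Smaller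
sets extend to a pair, which is a nonedge or lies in a triangle by `h`. -/
theorem isMaximal_nonedgesAndTriangles (hV : 2 ≤ Fintype.card V)
    (h : ∀ x y, G.Adj x y → ∃ z, G.Adj x z ∧ G.Adj y z) :
    IsMaximalTwoThreeAntichain (nonedgesAndTriangles G) where
  card_mem A hA := by
    simp only [nonedgesAndTriangles, mem_union, SimpleGraph.mem_cliqueFinset_iff,
      SimpleGraph.isNClique_iff] at hA
    tauto
  antichain := by
    intro A hA B hB hne hsub
    have hlt := card_lt_card (hsub.ssubset_of_ne hne)
    simp only [nonedgesAndTriangles, coe_union, Set.mem_union, mem_coe,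
      SimpleGraph.mem_cliqueFinset_iff, SimpleGraph.isNClique_iff] at hA hB
    have hA2 : Gᶜ.IsClique A ∧ #A = 2 := by
      rcases hA with hA | hA
      · exact hA
      · omega
    have hB3 : G.IsClique B := by
      rcases hB with hB | hB
      · omega
      · exact hB.1
    obtain ⟨x, y, hxy, rfl⟩ := card_eq_two.1 hA2.2
    exact (hA2.1 (by simp) (by simp) hxy).2 (hB3 (hsub (by simp)) (hsub (by simp)) hxy)
  maximal := by
    have key : ∀ x y : V, x ≠ y → ∃ A ∈ nonedgesAndTriangles G, {x, y} ⊆ A := by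
      intro x y hxy
      by_cases hadj : G.Adj x y
      · obtain ⟨z, hz⟩ := h x y hadj
        refine ⟨{x, y, z}, ?_, ?_⟩
        · have := SimpleGraph.is3Clique_triple_iff.2 ⟨hadj, hz⟩
          exact (triple_mem_nonedgesAndTriangles this.card_eq).2 this.isClique
        · simp [insert_subset_iff]
      · exact ⟨{x, y}, pair_mem_nonedgesAndTriangles.2 ⟨hxy, hadj⟩, Subset.rfl⟩
    intro X hX
    by_cases hcl : G.IsClique X
    · by_cases hX3 : 3 ≤ #X
      · obtain ⟨T, hTX, hT⟩ := exists_subset_card_eq hX3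
        exact ⟨T, (triple_mem_nonedgesAndTriangles hT).2 (hcl.subset (by exact_mod_cast hTX)),
          Or.inr hTX⟩
      · obtain ⟨Y, hXY, -, hY⟩ := exists_subsuperset_card_eq (subset_univ X)
          (by omega : #X ≤ 2) (by simpa using hV)
        obtain ⟨x, y, hxy, rfl⟩ := card_eq_two.1 hY
        obtain ⟨A, hA, hsub⟩ := key x y hxy
        exact ⟨A, hA, Or.inl (hXY.trans hsub)⟩
    · simp only [SimpleGraph.IsClique, Set.Pairwise] at hcl
      push Not at hcl
      obtain ⟨x, hx, y, hy, hxy, hadj⟩ := hcl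
      exact ⟨{x, y}, pair_mem_nonedgesAndTriangles.2 ⟨hxy, hadj⟩,
        Or.inr (by simpa [insert_subset_iff] using ⟨hx, hy⟩)⟩

end Graph

/-! ### From antichains to graphs -/

section Antichain
variable {V : Type*} [DecidableEq V] {𝒜 : Finset (Finset V)}

/-- A triangle outside the family would be comparable to a member; by size, that member would be a
pair inside the triangle, hence a nonedge. -/
theorem IsMaximalTwoThreeAntichain.isClique_iff (h : IsMaximalTwoThreeAntichain 𝒜)
    {A : Finset V} (hA : #A = 3) : A ∈ 𝒜 ↔ (antichainGraph 𝒜).IsClique A := by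
  constructor
  · intro hm x hx y hy hxy
    refine ⟨hxy, fun hp => ?_⟩
    have := h.antichain hp hm (by rintro rfl; rw [card_pair hxy] at hA; omega)
    exact this (by simpa [insert_subset_iff] using ⟨hx, hy⟩)
  · intro hc
    by_contra hm
    obtain ⟨B, hB, hsub⟩ := h.maximal A hm
    rcases hsub with hsub | hsub
    · have := card_le_card hsub
      have hBc := h.card_mem B hB
      have := eq_of_subset_of_card_le hsub (by omega)
      exact hm (this ▸ hB)
    · rcases h.card_mem B hB with hBc | hBc
      · obtain ⟨x, y, hxy, rfl⟩ := card_eq_two.1 hBc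
        exact (hc (hsub (by simp)) (hsub (by simp)) hxy).2 hB
      · have := eq_of_subset_of_card_le hsub (by omega)
        exact hm (this ▸ hB)

/-- A missing pair must be comparable to a member, and by size this is a triple above it. -/
theorem IsMaximalTwoThreeAntichain.exists_common (h : IsMaximalTwoThreeAntichain 𝒜)
    {x y : V} (hxy : (antichainGraph 𝒜).Adj x y) :
    ∃ z, (antichainGraph 𝒜).Adj x z ∧ (antichainGraph 𝒜).Adj y z := by
  obtain ⟨B, hB, hsub⟩ := h.maximal _ hxy.2
  have hB3 : #B = 3 ∧ {x, y} ⊆ B := by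
    have h2 := card_pair hxy.1
    have hBc := h.card_mem B hB
    rcases hsub with hsub | hsub
    · refine ⟨?_, hsub⟩
      rcases hBc with hBc | hBc
      · have := eq_of_subset_of_card_le hsub (by omega)
        exact absurd (this ▸ hB) hxy.2
      · exact hBc
    · have := card_le_card hsub
      have := eq_of_subset_of_card_le hsub (by omega)
      exact absurd (this ▸ hB) hxy.2
  have hcl := (h.isClique_iff hB3.1).1 hB
  obtain ⟨z, hz, hz'⟩ := exists_mem_notMem_of_card_lt_card
    (by rw [card_pair hxy.1, hB3.1]; omega : #({x, y} : Finset V) < #B)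
  simp only [mem_insert, mem_singleton, not_or] at hz'
  exact ⟨z, hcl (hB3.2 (by simp)) hz (Ne.symm hz'.1), hcl (hB3.2 (by simp)) hz (Ne.symm hz'.2)⟩

theorem IsMaximalTwoThreeAntichain.eq_nonedgesAndTriangles [Fintype V]
    [DecidableRel (antichainGraph 𝒜).Adj] (h : IsMaximalTwoThreeAntichain 𝒜) :
    𝒜 = nonedgesAndTriangles (antichainGraph 𝒜) := by
  ext A
  by_cases h2 : #A = 2
  · obtain ⟨x, y, hxy, rfl⟩ := card_eq_two.1 h2
    rw [pair_mem_nonedgesAndTriangles]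
    simp [antichainGraph, hxy]
  by_cases h3 : #A = 3
  · rw [triple_mem_nonedgesAndTriangles h3, h.isClique_iff h3]
  constructor
  · intro hA; have := h.card_mem A hA; omega
  · intro hA
    simp only [nonedgesAndTriangles, mem_union, SimpleGraph.mem_cliqueFinset_iff,
      SimpleGraph.isNClique_iff] at hA
    omega

theorem familyIsomorphic_of_iso [Fintype V] {ℬ : Finset (Finset V)}
    (hA : IsMaximalTwoThreeAntichain 𝒜) (hB : IsMaximalTwoThreeAntichain ℬ)
    (e : antichainGraph 𝒜 ≃g antichainGraph ℬ) : FamilyIsomorphic 𝒜 ℬ := by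
  refine ⟨e.toEquiv, fun A => ?_⟩
  have hcard : #(A.map e.toEquiv.toEmbedding) = #A := card_map _
  by_cases h2 : #A = 2
  · obtain ⟨x, y, hxy, rfl⟩ := card_eq_two.1 h2
    have h : (e x ≠ e y ∧ {e x, e y} ∉ ℬ) ↔ (x ≠ y ∧ {x, y} ∉ 𝒜) :=
      e.map_adj_iff (v := x) (w := y)
    have hne := e.injective.ne hxy
    rw [map_insert, map_singleton]
    change _ ↔ {e x, e y} ∈ ℬ
    tauto
  by_cases h3 : #A = 3
  · rw [hA.isClique_iff h3, hB.isClique_iff (hcard.trans h3)]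
    simp only [SimpleGraph.IsClique, coe_map, Equiv.coe_toEmbedding, Set.Pairwise,
      Set.forall_mem_image]
    simp only [ne_eq, EmbeddingLike.apply_eq_iff_eq]
    refine forall₅_congr fun x _ y _ _ => ?_
    exact (e.map_adj_iff (v := x) (w := y)).symm
  constructor
  · intro h; have := hA.card_mem A h; omega
  · intro h; have := hB.card_mem _ h; omega

end Antichain

/-! ### Quadrangle graphs: uniqueness of triangles and regularity -/

/-- A graph on `6t+3` vertices, regular of degree `2t+2`, with every edge in exactly one
triangle. -/
structure IsQuadrangleGraph {V : Type*} (G : SimpleGraph V) (t : ℕ) : Prop where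
  card_verts : Nat.card V = 6 * t + 3
  ncard_neighborSet : ∀ v, (G.neighborSet v).ncard = 2 * t + 2
  unique_triangle : EdgesInUniqueTriangle G

section
variable {V : Type*} [Fintype V] [DecidableEq V] {G : SimpleGraph V} [DecidableRel G.Adj]

theorem ncard_neighborSet_eq_degree {V : Type*} [Fintype V] {G : SimpleGraph V}
    [DecidableRel G.Adj] (v : V) : (G.neighborSet v).ncard = G.degree v := by
  rw [Set.ncard_eq_toFinset_card', ← G.card_neighborFinset_eq_degree]; rfl

theorem IsQuadrangleGraph.degree_eq {V : Type*} [Fintype V] {G : SimpleGraph V}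
    [DecidableRel G.Adj] {t : ℕ} (h : IsQuadrangleGraph G t) (v : V) :
    G.degree v = 2 * t + 2 := by
  rw [← ncard_neighborSet_eq_degree, h.ncard_neighborSet]

theorem IsQuadrangleGraph.fintype_card {V : Type*} [Fintype V] {G : SimpleGraph V} {t : ℕ}
    (h : IsQuadrangleGraph G t) :
    Fintype.card V = 6 * t + 3 := by
  rw [← Nat.card_eq_fintype_card, h.card_verts]

theorem two_mul_card_triangles_of_unique (h : EdgesInUniqueTriangle G) (v : V) :
    2 * #{T ∈ G.cliqueFinset 3 | v ∈ T} = G.degree v := by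
  rw [two_mul_card_triangles, sum_congr rfl fun u hu =>
    card_common_eq_one h ((G.mem_neighborFinset v u).1 hu)]
  simp

theorem IsQuadrangleGraph.isRegularFamily {t : ℕ} (h : IsQuadrangleGraph G t) :
    IsRegularFamily (nonedgesAndTriangles G) (5 * t + 1) := by
  intro v
  have h1 := card_nonedgesAndTriangles_through (G := G) v
  have h2 := two_mul_card_triangles_of_unique h.unique_triangle v
  have h3 := h.degree_eq v
  have h4 := h.fintype_card
  omega

/-- Each triangle dominates all vertices. -/
theorem IsQuadrangleGraph.adj_triangle {t : ℕ} (h : IsQuadrangleGraph G t) {x y z : V}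
    (hxy : G.Adj x y) (hyz : G.Adj y z) (hxz : G.Adj x z) (w : V) :
    G.Adj x w ∨ G.Adj y w ∨ G.Adj z w := by
  -- The degrees sum to `6t+6`, which is exactly the number of vertices plus one common neighbour
  -- per edge.
  apply adj_of_card_le_degree_sum
  rw [card_common_eq_one h.unique_triangle hxy, card_common_eq_one h.unique_triangle hyz,
    card_common_eq_one h.unique_triangle hxz, h.degree_eq, h.degree_eq, h.degree_eq,
    h.fintype_card]
  omega

/-- A graph whose edges lie in triangles and which satisfies the local equation of an extremal
antichain has all its edges in unique triangles. -/
theorem unique_triangle_of_local_equation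
    (hex : ∀ x y, G.Adj x y → ∃ z, G.Adj x z ∧ G.Adj y z)
    (hloc : ∀ v, 6 * G.degree v = 6 * #{T ∈ G.cliqueFinset 3 | v ∈ T} + Fintype.card V + 3) :
    EdgesInUniqueTriangle G := by
  set c : V → V → ℕ := fun v u => #(G.neighborFinset v ∩ G.neighborFinset u) with hc
  have hc1 : ∀ v u, G.Adj v u → 1 ≤ c v u := by
    intro v u h
    obtain ⟨z, hz⟩ := hex v u h
    exact card_pos.2 ⟨z, by simpa using hz⟩
  -- The sum of the excesses `c v u - 1` at `v` is `2T - d`; with the local equation, `3d` is `n +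
  -- 3` plus three times this sum.
  have hsum : ∀ v, ∑ u ∈ G.neighborFinset v, (c v u - 1) + G.degree v =
      2 * #{T ∈ G.cliqueFinset 3 | v ∈ T} := by
    intro v
    rw [two_mul_card_triangles, ← G.card_neighborFinset_eq_degree, card_eq_sum_ones,
      ← sum_add_distrib]
    refine sum_congr rfl fun u hu => ?_
    have : 1 ≤ #(G.neighborFinset v ∩ G.neighborFinset u) := hc1 v u (by simpa using hu)
    simp only [hc]; omega
  have hlow : ∀ v u w, G.Adj v u → G.Adj v w → u ≠ w →
      (c v u - 1) + (c v w - 1) ≤ ∑ u ∈ G.neighborFinset v, (c v u - 1) := by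
    intro v u w hu hw hne
    rw [← sum_pair (f := fun u => c v u - 1) hne]
    apply sum_le_sum_of_subset
    simp [insert_subset_iff, hu, hw]
  have hsymm : ∀ v u, c v u = c u v := fun v u => by simp only [hc, inter_comm]
  apply edgesInUniqueTriangle_of_card
  intro x y hxy
  obtain ⟨z, hxz, hyz⟩ := hex x y hxy
  have h1 := hlow x y z hxy hxz hyz.ne
  have h2 := hlow y x z hxy.symm hyz hxz.ne
  have h3 := hlow z x y hxz.symm hyz.symm hxy.ne
  have hd : G.degree x + G.degree y + G.degree z ≤ Fintype.card V + c x y + c y z + c x z :=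
    degree_sum_le G x y z
  have e1 := hsum x; have e2 := hsum y; have e3 := hsum z
  have l1 := hloc x; have l2 := hloc y; have l3 := hloc z
  have p1 := hc1 x y hxy; have p2 := hc1 y z hyz; have p3 := hc1 x z hxz
  have s1 := hsymm x y; have s2 := hsymm y z; have s3 := hsymm x z
  change c x y = 1
  -- Let `E` be the total excess of the three edges. The excess sums at `x`, `y`, `z` add up to at
  -- least `2E`, while the degree bound says they add up to at most `E`; hence `E = 0`.
  omega

theorem IsQuadrangleGraph.of_local_equation (hV : 3 ≤ Fintype.card V)
    (hex : ∀ x y, G.Adj x y → ∃ z, G.Adj x z ∧ G.Adj y z)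
    (hloc : ∀ v, 6 * G.degree v = 6 * #{T ∈ G.cliqueFinset 3 | v ∈ T} + Fintype.card V + 3) :
    ∃ t, IsQuadrangleGraph G t := by
  have hu := unique_triangle_of_local_equation hex hloc
  have hd : ∀ v, 3 * G.degree v = Fintype.card V + 3 ∧
      2 * #{T ∈ G.cliqueFinset 3 | v ∈ T} = G.degree v := by
    intro v
    have h1 := two_mul_card_triangles_of_unique hu v
    have h2 := hloc v
    omega
  obtain ⟨v⟩ : Nonempty V := Fintype.card_pos_iff.1 (by omega)
  obtain ⟨h1, h2⟩ := hd v
  -- A vertex of a quadrangle graph lies on `t + 1` triangles.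
  refine ⟨#{T ∈ G.cliqueFinset 3 | v ∈ T} - 1, ?_, fun w => ?_, hu⟩
  · rw [Nat.card_eq_fintype_card]; omega
  · rw [ncard_neighborSet_eq_degree]; have := hd w; omega

theorem sum_card_triangles_through_mul (f : V → ℕ) :
    ∑ v, f v * #{T ∈ G.cliqueFinset 3 | v ∈ T} = ∑ T ∈ G.cliqueFinset 3, ∑ v ∈ T, f v := by
  have h : ∀ T ∈ G.cliqueFinset 3, ∑ v ∈ T, f v = ∑ v, if v ∈ T then f v else 0 := by
    intro T _; simp
  rw [sum_congr rfl h, sum_comm]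
  refine sum_congr rfl fun v _ => ?_
  rw [← sum_filter, sum_const, smul_eq_mul, mul_comm]

theorem IsQuadrangleGraph.of_card_edges (hV : 3 ≤ Fintype.card V)
    (hu : EdgesInUniqueTriangle G)
    (he : 6 * #G.edgeFinset = Fintype.card V * (Fintype.card V + 3)) :
    ∃ t, IsQuadrangleGraph G t := by
  set n := Fintype.card V with hn
  have ht := two_mul_card_triangles_of_unique hu
  have hT : ∀ T ∈ G.cliqueFinset 3, ∑ v ∈ T, G.degree v ≤ n + 3 := by
    intro T hT
    rw [SimpleGraph.mem_cliqueFinset_iff, SimpleGraph.is3Clique_iff] at hT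
    obtain ⟨x, y, z, hxy, hxz, hyz, rfl⟩ := hT
    rw [sum_insert (by simp [hxy.ne, hxz.ne]), sum_pair hyz.ne]
    have := degree_sum_le G x y z
    rw [card_common_eq_one hu hxy, card_common_eq_one hu hyz, card_common_eq_one hu hxz] at this
    omega
  have hd := G.sum_degrees_eq_twice_card_edges
  have h1 : ∑ v, G.degree v = 6 * #(G.cliqueFinset 3) := by
    have h := sum_card_triangles_through_mul (G := G) (fun _ => 1)
    have h3 : ∀ T ∈ G.cliqueFinset 3, ∑ v ∈ T, 1 = 3 := by
      intro T hT
      rw [← card_eq_sum_ones, ((G.mem_cliqueFinset_iff).1 hT).card_eq]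
    rw [sum_congr rfl h3, sum_const, smul_eq_mul] at h
    simp only [one_mul] at h
    rw [← sum_congr rfl fun v _ => ht v, ← mul_sum, h]
    ring
  have h2 : ∑ v, G.degree v ^ 2 ≤ 2 * (#(G.cliqueFinset 3) * (n + 3)) := by
    have h := sum_card_triangles_through_mul (G := G) (fun v => G.degree v)
    have h' : ∑ v, G.degree v ^ 2 =
        2 * ∑ v, G.degree v * #{T ∈ G.cliqueFinset 3 | v ∈ T} := by
      rw [mul_sum]
      refine sum_congr rfl fun v _ => ?_
      rw [mul_left_comm, ht v, sq]
    rw [h', h]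
    refine Nat.mul_le_mul_left 2 ?_
    simpa using sum_le_card_nsmul _ _ _ hT
  -- The required mean degree is `(n+3)/3`, so this is a scaled variance; the bound on the second
  -- moment makes it nonpositive.
  have h3 : ∑ v, (3 * (G.degree v : ℤ) - (n + 3)) ^ 2 ≤ 0 := by
    have e : ∑ v, (3 * (G.degree v : ℤ) - (n + 3)) ^ 2 =
        9 * ((∑ v, G.degree v ^ 2 : ℕ) : ℤ) - 6 * (n + 3) * ((∑ v, G.degree v : ℕ) : ℤ) +
          n * (n + 3) ^ 2 := by
      push_cast
      rw [mul_sum, mul_sum, ← sum_sub_distrib]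
      have : (n : ℤ) * (n + 3) ^ 2 = ∑ v : V, ((n : ℤ) + 3) ^ 2 := by simp [hn]
      rw [this, ← sum_add_distrib]
      exact sum_congr rfl fun v _ => by ring
    have h2' : ((∑ v, G.degree v ^ 2 : ℕ) : ℤ) ≤ 2 * (#(G.cliqueFinset 3) * (n + 3)) := by
      exact_mod_cast h2
    have h1' : ((∑ v, G.degree v : ℕ) : ℤ) = 6 * #(G.cliqueFinset 3) := by exact_mod_cast h1
    have hd' : (18 : ℤ) * #(G.cliqueFinset 3) = n * (n + 3) := by
      have : 18 * #(G.cliqueFinset 3) = n * (n + 3) := by omega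
      exact_mod_cast this
    rw [e, h1']
    have : 18 * ((#(G.cliqueFinset 3) : ℤ) * (n + 3)) = n * (n + 3) ^ 2 := by
      rw [← mul_assoc, hd']; ring
    linarith
  have h4 : ∀ v, 3 * G.degree v = n + 3 := by
    intro v
    have h := (sum_eq_zero_iff_of_nonneg fun v _ => sq_nonneg _).1
      (le_antisymm h3 (sum_nonneg fun v _ => sq_nonneg _)) v (mem_univ v)
    have := pow_eq_zero_iff (two_ne_zero) |>.1 h
    omega
  obtain ⟨v⟩ : Nonempty V := Fintype.card_pos_iff.1 (by omega)
  have hv := h4 v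
  have htv := ht v
  refine ⟨#{T ∈ G.cliqueFinset 3 | v ∈ T} - 1, ?_, fun w => ?_, hu⟩
  · rw [Nat.card_eq_fintype_card]; omega
  · rw [ncard_neighborSet_eq_degree]; have := h4 w; omega

theorem IsQuadrangleGraph.card_edges {V : Type*} [Fintype V] {G : SimpleGraph V}
    [DecidableRel G.Adj] {t : ℕ} (h : IsQuadrangleGraph G t) :
    6 * #G.edgeFinset = Fintype.card V * (Fintype.card V + 3) := by
  have hd := G.sum_degrees_eq_twice_card_edges
  rw [sum_congr rfl fun v _ => h.degree_eq v, sum_const, card_univ, smul_eq_mul,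
    h.fintype_card] at hd
  rw [h.fintype_card]
  nlinarith

end

/-! ### Extremal antichains and edge counts as quadrangle graphs -/

section Extremal
variable {n : ℕ} {𝒜 : Finset (Finset (Fin n))}

theorem IsExtremalTwoThreeAntichain.isQuadrangleGraph (hn : 3 ≤ n)
    (h : IsExtremalTwoThreeAntichain 𝒜) : ∃ t, IsQuadrangleGraph (antichainGraph 𝒜) t := by
  classical
  obtain ⟨hmax, r, hr, hreg⟩ := h
  refine IsQuadrangleGraph.of_local_equation (by simpa using hn)
    (fun x y hxy => hmax.exists_common hxy) fun v => ?_
  have h1 := card_nonedgesAndTriangles_through (G := antichainGraph 𝒜) v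
  rw [← hmax.eq_nonedgesAndTriangles, hreg v, Fintype.card_fin] at h1
  have hr' : 6 * r + 9 = 5 * n := by
    have : (6 : ℚ) * r + 9 = 5 * n := by rw [hr]; ring
    exact_mod_cast this
  rw [Fintype.card_fin]
  omega

theorem IsQuadrangleGraph.isExtremal {G : SimpleGraph (Fin n)} [DecidableRel G.Adj] {t : ℕ}
    (h : IsQuadrangleGraph G t) : IsExtremalTwoThreeAntichain (nonedgesAndTriangles G) := by
  have hn : n = 6 * t + 3 := by simpa using h.card_verts
  refine ⟨isMaximal_nonedgesAndTriangles (by simp; omega)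
    fun x y hxy => (h.unique_triangle x y hxy).exists, 5 * t + 1, ?_, h.isRegularFamily⟩
  rw [hn]; push_cast; ring

theorem isQuadrangleGraph_iff_ncard_edgeSet (hn : 3 ≤ n) (G : SimpleGraph (Fin n)) :
    (EdgesInUniqueTriangle G ∧ (G.edgeSet.ncard : ℚ) = (n : ℚ) * ((n : ℚ) + 3) / 6) ↔
      ∃ t, IsQuadrangleGraph G t := by
  classical
  have hcard : (G.edgeSet.ncard : ℚ) = (n : ℚ) * ((n : ℚ) + 3) / 6 ↔
      6 * #G.edgeFinset = Fintype.card (Fin n) * (Fintype.card (Fin n) + 3) := by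
    rw [Fintype.card_fin, eq_div_iff (by norm_num), Set.ncard_eq_toFinset_card',
      ← SimpleGraph.edgeFinset, mul_comm]
    norm_cast
  rw [hcard]
  constructor
  · rintro ⟨h1, h2⟩
    exact IsQuadrangleGraph.of_card_edges (by simpa using hn) h1 h2
  · rintro ⟨t, ht⟩
    exact ⟨ht.unique_triangle, ht.card_edges⟩

end Extremal

theorem IsQuadrangleGraph.of_iso {V W : Type*} {G : SimpleGraph V} {H : SimpleGraph W} {t : ℕ}
    (h : IsQuadrangleGraph G t) (e : G ≃g H) : IsQuadrangleGraph H t where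
  card_verts := by rw [← Nat.card_congr e.toEquiv, h.card_verts]
  ncard_neighborSet v := by
    have : H.neighborSet v = e '' G.neighborSet (e.symm v) := by
      ext w
      obtain ⟨w, rfl⟩ := e.surjective w
      obtain ⟨v, rfl⟩ := e.surjective v
      rw [e.injective.mem_set_image, SimpleGraph.mem_neighborSet,
        SimpleGraph.mem_neighborSet, e.map_adj_iff, e.symm_apply_apply]
    rw [this, Set.ncard_image_of_injective _ e.injective, h.ncard_neighborSet]
  unique_triangle x y hxy := by
    obtain ⟨z, hz, hu⟩ := h.unique_triangle (e.symm x) (e.symm y) (e.symm.map_adj_iff.2 hxy)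
    refine ⟨e z, ⟨?_, ?_⟩, fun w hw => ?_⟩
    · rw [← e.map_adj_iff, e.apply_symm_apply] at hz; exact hz.1
    · have := e.map_adj_iff.2 hz.2; rwa [e.apply_symm_apply] at this
    · rw [← hu (e.symm w) ⟨e.symm.map_adj_iff.2 hw.1, e.symm.map_adj_iff.2 hw.2⟩,
        e.apply_symm_apply]

/-! ### Quadrangle graphs and generalized quadrangles -/

section
variable {V : Type*} [Fintype V] [DecidableEq V] {G : SimpleGraph V} [DecidableRel G.Adj]

theorem eq_of_pair_mem_triangles (h : EdgesInUniqueTriangle G) {S T : Finset V}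
    (hS : G.IsNClique 3 S) (hT : G.IsNClique 3 T) {p q : V} (hpq : p ≠ q) (hpS : p ∈ S)
    (hqS : q ∈ S) (hpT : p ∈ T) (hqT : q ∈ T) : S = T := by
  have hadj := hS.isClique hpS hqS hpq
  have hc := (card_triangles_on_edge G hadj).trans (card_common_eq_one h hadj)
  apply card_le_one.1 hc.le
  · simp [SimpleGraph.mem_cliqueFinset_iff, hS, hpS, hqS]
  · simp [SimpleGraph.mem_cliqueFinset_iff, hT, hpT, hqT]

/-- Projection exists because a triangle dominates every point; it is unique because a point off the
line with two neighbours on it would give a second triangle on an edge of that line. -/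
theorem IsQuadrangleGraph.isGeneralizedQuadrangle {t : ℕ} (h : IsQuadrangleGraph G t)
    (ht : 1 ≤ t) :
    IsGeneralizedQuadrangle (fun (p : V) (T : {T : Finset V // G.IsNClique 3 T}) => p ∈ T.1)
      2 t := by
  have hcard := h.fintype_card
  have hlines : ∀ p : V, {T : {T : Finset V // G.IsNClique 3 T} | p ∈ T.1}.ncard = t + 1 := by
    intro p
    have h1 := two_mul_card_triangles_of_unique h.unique_triangle p
    rw [h.degree_eq] at h1
    rw [← Set.ncard_image_of_injective _ Subtype.val_injective]
    have : Subtype.val '' {T : {T : Finset V // G.IsNClique 3 T} | p ∈ T.1} =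
        (({T ∈ G.cliqueFinset 3 | p ∈ T} : Finset (Finset V)) : Set (Finset V)) := by
      ext T; simp [SimpleGraph.mem_cliqueFinset_iff, and_comm]
    rw [this, Set.ncard_coe_finset]
    omega
  have hP : Nonempty V := Fintype.card_pos_iff.1 (by omega)
  have hline : ∀ p q : V, p ≠ q → ∀ l m : {T : Finset V // G.IsNClique 3 T},
      p ∈ l.1 → q ∈ l.1 → p ∈ m.1 → q ∈ m.1 → l = m := fun p q hpq l m h1 h2 h3 h4 =>
    Subtype.ext (eq_of_pair_mem_triangles h.unique_triangle l.2 m.2 hpq h1 h2 h3 h4)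
  refine ⟨hP, ?_, by norm_num, ht, hlines, ?_, hline, ?_, ?_⟩
  · obtain ⟨p⟩ := hP
    obtain ⟨l, -⟩ := Set.nonempty_of_ncard_ne_zero (by rw [hlines p]; omega)
    exact ⟨l⟩
  · intro l
    have := Set.ncard_coe_finset l.1
    rw [l.2.card_eq] at this
    exact this
  · intro l m hlm p q h1 h2 h3 h4
    by_contra hpq
    exact hlm (hline p q hpq l m h1 h3 h2 h4)
  · rintro p ⟨l, hl⟩ hp
    change p ∉ l at hp
    obtain ⟨v, hv, hpv⟩ : ∃ v ∈ l, G.Adj p v := by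
      obtain ⟨x, y, z, hxy, hxz, hyz, rfl⟩ := SimpleGraph.is3Clique_iff.1 hl
      rcases h.adj_triangle hxy hyz hxz p with h' | h' | h'
      · exact ⟨x, by simp, h'.symm⟩
      · exact ⟨y, by simp, h'.symm⟩
      · exact ⟨z, by simp, h'.symm⟩
    obtain ⟨z, hz, -⟩ := h.unique_triangle p v hpv
    have hm : G.IsNClique 3 {p, v, z} := SimpleGraph.is3Clique_triple_iff.2 ⟨hpv, hz⟩
    refine ⟨(v, ⟨{p, v, z}, hm⟩), ⟨by simp, by simp, hv⟩, ?_⟩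
    rintro ⟨q, m⟩ ⟨h1, h2, h3⟩
    dsimp only at h1 h2 h3
    have hqp : p ≠ q := by rintro rfl; exact hp h3
    have hpq := m.2.isClique h1 h2 hqp
    have hqv : q = v := by
      by_contra hne
      have hvq := hl.isClique hv h3 (Ne.symm hne)
      have hc : G.IsNClique 3 {p, v, q} := SimpleGraph.is3Clique_triple_iff.2 ⟨hpv, hpq, hvq⟩
      have := eq_of_pair_mem_triangles h.unique_triangle hc hl hne (by simp) (by simp) h3 hv
      exact hp (this ▸ by simp)
    subst hqv
    rw [Prod.mk.injEq]
    exact ⟨rfl, hline p q hqp _ _ h1 h2 (by simp) (by simp)⟩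

theorem adj_iff_exists_triangle {V : Type*} [DecidableEq V] {G : SimpleGraph V}
    (h : EdgesInUniqueTriangle G) (x y : V) :
    G.Adj x y ↔ x ≠ y ∧ ∃ T : {T : Finset V // G.IsNClique 3 T}, x ∈ T.1 ∧ y ∈ T.1 := by
  constructor
  · intro hxy
    obtain ⟨z, hz, -⟩ := h x y hxy
    exact ⟨hxy.ne, ⟨{x, y, z}, SimpleGraph.is3Clique_triple_iff.2 ⟨hxy, hz⟩⟩, by simp, by simp⟩
  · rintro ⟨hne, T, hx, hy⟩
    exact T.2.isClique hx hy hne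

end

section
variable {P L : Type*} {I : P → L → Prop} {t : ℕ}

/-- The third vertex is the third point of the line. A common neighbour off that line would project
to both ends of the edge. -/
theorem IsGeneralizedQuadrangle.edgesInUniqueTriangle (h : IsGeneralizedQuadrangle I 2 t) :
    EdgesInUniqueTriangle (collinearityGraph I) := by
  rintro x y ⟨hxy, l, hxl, hyl⟩
  have hfin : {p | I p l}.Finite := Set.finite_of_ncard_ne_zero (by rw [h.points_on]; omega)
  have h1 : ({p | I p l} \ {x, y}).ncard = 1 := by
    have := Set.ncard_sdiff_add_ncard_of_subset (s := {x, y}) (t := {p | I p l})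
      (by simp [Set.insert_subset_iff, hxl, hyl]) hfin
    rw [h.points_on, Set.ncard_pair hxy] at this
    omega
  obtain ⟨z, hz⟩ := Set.ncard_eq_one.1 h1
  have hz' : ∀ w, (I w l ∧ w ≠ x ∧ w ≠ y) ↔ w = z := fun w => by
    simpa using congrArg (w ∈ ·) hz
  obtain ⟨hzl, hzx, hzy⟩ := (hz' z).2 rfl
  refine ⟨z, ⟨⟨hzx.symm, l, hxl, hzl⟩, ⟨hzy.symm, l, hyl, hzl⟩⟩, ?_⟩
  rintro w ⟨⟨hxw, m, hxm, hwm⟩, ⟨hyw, k, hyk, hwk⟩⟩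
  by_cases hwl : I w l
  · exact (hz' w).1 ⟨hwl, hxw.symm, hyw.symm⟩
  · have := (h.project w l hwl).unique (y₁ := (x, m)) (y₂ := (y, k)) ⟨hwm, hxm, hxl⟩
      ⟨hwk, hyk, hyl⟩
    exact absurd (congrArg Prod.fst this) hxy

theorem IsGeneralizedQuadrangle.ncard_neighborSet (h : IsGeneralizedQuadrangle I 2 t) (p : P) :
    ((collinearityGraph I).neighborSet p).ncard = 2 * t + 2 := by
  classical
  have hL : {l | I p l}.Finite := Set.finite_of_ncard_ne_zero (by rw [h.lines_through]; omega)
  have hP : ∀ l, {q | I q l}.Finite := fun l =>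
    Set.finite_of_ncard_ne_zero (by rw [h.points_on]; omega)
  have hN : (collinearityGraph I).neighborSet p =
      ((hL.toFinset.biUnion fun l => (hP l).toFinset.erase p : Finset P) : Set P) := by
    ext q
    simp only [SimpleGraph.mem_neighborSet, collinearityGraph, coe_biUnion, Set.mem_iUnion,
      mem_coe, Set.Finite.mem_toFinset, Set.mem_ofPred_eq, mem_erase, exists_prop]
    constructor
    · rintro ⟨hne, l, h1, h2⟩; exact ⟨l, h1, hne.symm, h2⟩
    · rintro ⟨l, h1, hne, h2⟩; exact ⟨hne.symm, l, h1, h2⟩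
  rw [hN, Set.ncard_coe_finset, card_biUnion]
  · have : ∀ l ∈ hL.toFinset, #((hP l).toFinset.erase p) = 2 := by
      intro l hl
      rw [card_erase_of_mem (by simpa using hl), ← Set.ncard_eq_toFinset_card _ (hP l),
        h.points_on]
    rw [sum_congr rfl this, sum_const, ← Set.ncard_eq_toFinset_card _ hL, h.lines_through,
      smul_eq_mul]
    ring
  · intro l hl m hm hlm
    rw [Function.onFun, disjoint_left]
    intro q h1 h2
    simp only [mem_erase, Set.Finite.mem_toFinset, Set.mem_ofPred_eq] at h1 h2 hl hm
    exact hlm (h.line_unique p q h1.1.symm l m (by simpa using hl) h1.2 (by simpa using hm) h2.2)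

end

theorem IsQuadrangleGraph.eq_top {V : Type*} [Finite V] {G : SimpleGraph V}
    (h : IsQuadrangleGraph G 0) : G = ⊤ := by
  classical
  have := Fintype.ofFinite V
  ext x y
  rw [SimpleGraph.top_adj]
  refine ⟨fun h => h.ne, fun hne => ?_⟩
  have hN : G.neighborFinset x = univ.erase x := by
    apply eq_of_subset_of_card_le
    · intro w hw; simpa using ((G.mem_neighborFinset x w).1 hw).ne'
    · rw [G.card_neighborFinset_eq_degree, h.degree_eq, card_erase_of_mem (mem_univ x),
        card_univ, h.fintype_card]
  rw [← G.mem_neighborFinset, hN]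
  simpa using hne.symm

theorem isQuadrangleGraph_top : IsQuadrangleGraph (⊤ : SimpleGraph (Fin 3)) 0 where
  card_verts := by simp
  ncard_neighborSet v := by rw [ncard_neighborSet_eq_degree]; simp
  unique_triangle := by simp only [EdgesInUniqueTriangle, ExistsUnique, SimpleGraph.top_adj]; decide

/-- The triangle stands apart because it is the case `t = 0`, which a generalized quadrangle
excludes. -/
theorem exists_isQuadrangleGraph_iff {n : ℕ} (G : SimpleGraph (Fin n)) :
    (∃ t, IsQuadrangleGraph G t) ↔
      ((n = 3 ∧ G = ⊤) ∨
        ∃ t : ℕ, n = 6 * t + 3 ∧ ∃ (P L : Type) (I : P → L → Prop),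
          IsGeneralizedQuadrangle I 2 t ∧ Nonempty (G ≃g collinearityGraph I)) := by
  classical
  constructor
  · rintro ⟨t, h⟩
    have hn : n = 6 * t + 3 := by simpa using h.card_verts
    rcases Nat.eq_zero_or_pos t with rfl | ht
    · exact Or.inl ⟨hn, h.eq_top⟩
    · refine Or.inr ⟨t, hn, Fin n, {T : Finset (Fin n) // G.IsNClique 3 T}, _,
        h.isGeneralizedQuadrangle ht, ⟨⟨Equiv.refl _, ?_⟩⟩⟩
      intro x y
      exact (adj_iff_exists_triangle h.unique_triangle x y).symm
  · rintro (⟨rfl, rfl⟩ | ⟨t, hn, P, L, I, hI, ⟨e⟩⟩)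
    · exact ⟨0, isQuadrangleGraph_top⟩
    · refine ⟨t, IsQuadrangleGraph.of_iso ⟨?_, hI.ncard_neighborSet, hI.edgesInUniqueTriangle⟩
        e.symm⟩
      rw [← Nat.card_congr e.toEquiv, Nat.card_eq_fintype_card, Fintype.card_fin, hn]

/-! ### Explicit models for `t = 0, 1, 2, 4` -/

/-- A graph on a type of size `6t+3` in which `third x y` completes every edge to a triangle,
uniquely. -/
theorem IsQuadrangleGraph.of_third {V : Type*} [Fintype V] [DecidableEq V] {G : SimpleGraph V}
    [DecidableRel G.Adj] {t : ℕ} (hc : Fintype.card V = 6 * t + 3)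
    (hd : ∀ v, #{w | G.Adj v w} = 2 * t + 2) (third : V → V → V)
    (h1 : ∀ x y, G.Adj x y → G.Adj x (third x y) ∧ G.Adj y (third x y))
    (h2 : ∀ x y z, G.Adj x y ∧ G.Adj x z ∧ G.Adj y z → z = third x y) :
    IsQuadrangleGraph G t where
  card_verts := by rw [Nat.card_eq_fintype_card, hc]
  ncard_neighborSet v := by
    rw [ncard_neighborSet_eq_degree, ← hd v, ← G.card_neighborFinset_eq_degree,
      G.neighborFinset_eq_filter]
  unique_triangle x y hxy := ⟨third x y, h1 x y hxy, fun z hz => h2 x y z ⟨hxy, hz⟩⟩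

/-- The `3 × 3` grid. -/
def gridGraph : SimpleGraph (ZMod 3 × ZMod 3) where
  Adj p q := p ≠ q ∧ (p.1 = q.1 ∨ p.2 = q.2)
  symm := ⟨fun _ _ h => ⟨h.1.symm, h.2.imp Eq.symm Eq.symm⟩⟩
  loopless := ⟨fun _ h => h.1 rfl⟩

instance : DecidableRel gridGraph.Adj := fun p q =>
  inferInstanceAs (Decidable (p ≠ q ∧ (p.1 = q.1 ∨ p.2 = q.2)))

/-- The three points of a row or column sum to zero. -/
theorem isQuadrangleGraph_gridGraph : IsQuadrangleGraph gridGraph 1 :=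
  .of_third (by decide) (by decide) (fun p q => -p - q) (by decide) (by decide)

/-- The symplectic form on `𝔽₂⁴`. -/
def symplecticForm (p q : ZMod 2 × ZMod 2 × ZMod 2 × ZMod 2) : ZMod 2 :=
  p.1 * q.2.1 + p.2.1 * q.1 + p.2.2.1 * q.2.2.2 + p.2.2.2 * q.2.2.1

/-- Nonzero vectors of `𝔽₂⁴`, adjacent if distinct and orthogonal for the symplectic form. -/
def symplecticGraph : SimpleGraph {p : ZMod 2 × ZMod 2 × ZMod 2 × ZMod 2 // p ≠ 0} where
  Adj p q := p ≠ q ∧ symplecticForm p q = 0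
  symm := ⟨fun p q h => ⟨h.1.symm, by rw [← h.2]; simp only [symplecticForm]; ring⟩⟩
  loopless := ⟨fun _ h => h.1 rfl⟩

instance : DecidableRel symplecticGraph.Adj := fun p q =>
  inferInstanceAs (Decidable (p ≠ q ∧ symplecticForm p q = 0))

set_option synthInstance.maxSize 1000 in
theorem isQuadrangleGraph_symplecticGraph : IsQuadrangleGraph symplecticGraph 2 := by
  refine .of_third (by decide) (by decide +kernel)
    -- Totally isotropic lines are `{p, q, p + q}`. The default is used only when `p = q`, which is
    -- not an edge.
    (fun p q => if h : p.1 + q.1 = 0 then p else ⟨p.1 + q.1, h⟩) (by decide +kernel)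
    (by decide +kernel)

/-- The cover of `K₉` on `𝔽₃² × 𝔽₃` given by the symplectic form on `𝔽₃²`, with its fibres
turned into triangles. -/
def symplecticCoverGraph : SimpleGraph (ZMod 3 × ZMod 3 × ZMod 3) where
  Adj p q := p ≠ q ∧ if p.1 = q.1 ∧ p.2.1 = q.2.1 then True else
    p.2.2 - q.2.2 = p.1 * q.2.1 - p.2.1 * q.1
  symm := ⟨by decide +kernel⟩
  loopless := ⟨fun _ h => h.1 rfl⟩

instance : DecidableRel symplecticCoverGraph.Adj := fun p q =>
  inferInstanceAs (Decidable (p ≠ q ∧ if p.1 = q.1 ∧ p.2.1 = q.2.1 then True else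
    p.2.2 - q.2.2 = p.1 * q.2.1 - p.2.1 * q.1))

theorem isQuadrangleGraph_symplecticCoverGraph : IsQuadrangleGraph symplecticCoverGraph 4 := by
  -- The triangles are affine lines over `𝔽₃`, so their points sum to zero.
  refine .of_third (by decide) (by decide +kernel) (fun p q => -p - q) (by decide +kernel)
    (by decide +kernel)

theorem IsQuadrangleGraph.exists_on_fin {V : Type*} [Fintype V] {G : SimpleGraph V} {t n : ℕ}
    (h : IsQuadrangleGraph G t) (hn : n = 6 * t + 3) :
    ∃ H : SimpleGraph (Fin n), IsQuadrangleGraph H t := by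
  have hc : Fintype.card V = n := by rw [← Nat.card_eq_fintype_card, h.card_verts, hn]
  exact ⟨_, h.of_iso (SimpleGraph.Iso.map (Fintype.equivFinOfCardEq hc) G)⟩

theorem exists_isQuadrangleGraph {t n : ℕ} (ht : t = 0 ∨ t = 1 ∨ t = 2 ∨ t = 4)
    (hn : n = 6 * t + 3) : ∃ H : SimpleGraph (Fin n), IsQuadrangleGraph H t := by
  rcases ht with rfl | rfl | rfl | rfl
  · exact isQuadrangleGraph_top.exists_on_fin hn
  · exact isQuadrangleGraph_gridGraph.exists_on_fin hn
  · exact isQuadrangleGraph_symplecticGraph.exists_on_fin hn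
  · exact isQuadrangleGraph_symplecticCoverGraph.exists_on_fin hn

/-! ### Frames on two nonadjacent points -/

/-- Two nonadjacent points `x`, `y` of a quadrangle graph, their common neighbours `z i`, and
the third points `a i`, `b i` of the triangles on `x, z i` and on `y, z i`. -/
structure QuadrangleFrame {V : Type*} (G : SimpleGraph V) (t : ℕ) where
  x : V
  y : V
  z : Fin (t + 1) → V
  a : Fin (t + 1) → V
  b : Fin (t + 1) → V
  ne : x ≠ y
  not_adj : ¬ G.Adj x y
  z_injective : Function.Injective z
  adj_xz : ∀ i, G.Adj x (z i)
  adj_yz : ∀ i, G.Adj y (z i)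
  adj_xa : ∀ i, G.Adj x (a i)
  adj_yb : ∀ i, G.Adj y (b i)
  adj_za : ∀ i, G.Adj (z i) (a i)
  adj_zb : ∀ i, G.Adj (z i) (b i)
  of_adj_x : ∀ v, G.Adj x v → ∃ i, v = z i ∨ v = a i
  of_adj_y : ∀ v, G.Adj y v → ∃ i, v = z i ∨ v = b i

theorem EdgesInUniqueTriangle.eq {V : Type*} {G : SimpleGraph V} (h : EdgesInUniqueTriangle G)
    {x y v w : V} (hxy : G.Adj x y) (hxv : G.Adj x v) (hyv : G.Adj y v) (hxw : G.Adj x w)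
    (hyw : G.Adj y w) : v = w :=
  (h x y hxy).unique ⟨hxv, hyv⟩ ⟨hxw, hyw⟩

section
variable {V : Type*} [Fintype V] [DecidableEq V] {G : SimpleGraph V} [DecidableRel G.Adj] {t : ℕ}

/-- Each of the `t + 1` triangles at `u` contains exactly one neighbour of `v`: at least one by
domination, and two would make `u` and `v` complete the same edge. -/
theorem IsQuadrangleGraph.card_common (h : IsQuadrangleGraph G t) {u v : V} (hne : u ≠ v)
    (hadj : ¬ G.Adj u v) : #(G.neighborFinset u ∩ G.neighborFinset v) = t + 1 := by
  have hT : #{T ∈ G.cliqueFinset 3 | u ∈ T} = t + 1 := by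
    have := two_mul_card_triangles_of_unique h.unique_triangle u
    rw [h.degree_eq] at this; omega
  rw [← hT, ← mul_one #(G.neighborFinset u ∩ _), ← mul_one #{T ∈ G.cliqueFinset 3 | u ∈ T}]
  apply card_mul_eq_card_mul (fun w T => w ∈ T)
  · intro w hw
    simp only [mem_inter, SimpleGraph.mem_neighborFinset] at hw
    rw [← card_common_eq_one h.unique_triangle hw.1, ← card_triangles_on_edge G hw.1,
      bipartiteAbove, filter_filter]
  · intro T hT
    simp only [mem_filter, SimpleGraph.mem_cliqueFinset_iff] at hT
    rw [card_eq_one]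
    obtain ⟨w, hwT, hvw⟩ : ∃ w ∈ T, G.Adj v w := by
      obtain ⟨x, y, z, hxy, hxz, hyz, rfl⟩ := SimpleGraph.is3Clique_iff.1 hT.1
      rcases h.adj_triangle hxy hyz hxz v with h' | h' | h'
      · exact ⟨x, by simp, h'.symm⟩
      · exact ⟨y, by simp, h'.symm⟩
      · exact ⟨z, by simp, h'.symm⟩
    have huw : u ≠ w := by rintro rfl; exact hadj hvw.symm
    refine ⟨w, ?_⟩
    ext q
    simp only [bipartiteBelow, mem_filter, mem_inter, SimpleGraph.mem_neighborFinset,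
      mem_singleton]
    constructor
    · rintro ⟨⟨huq, hvq⟩, hqT⟩
      by_contra hqw
      have hwq := hT.1.isClique hwT hqT (Ne.symm hqw)
      exact hne (h.unique_triangle.eq hwq (hT.1.isClique hwT hT.2 huw.symm) huq.symm hvw.symm
        hvq.symm)
    · rintro rfl
      exact ⟨⟨hT.1.isClique hT.2 hwT huw, hvw⟩, hwT⟩

theorem IsQuadrangleGraph.exists_frame (h : IsQuadrangleGraph G t) (ht : 1 ≤ t) :
    Nonempty (QuadrangleFrame G t) := by
  have hcard := h.fintype_card
  obtain ⟨x⟩ : Nonempty V := Fintype.card_pos_iff.1 (by omega)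
  obtain ⟨y, hy⟩ : ∃ y, y ∉ insert x (G.neighborFinset x) := by
    by_contra! hall
    have h1 := card_le_card (fun v _ => hall v : univ ⊆ insert x (G.neighborFinset x))
    have h2 := card_insert_le x (G.neighborFinset x)
    rw [G.card_neighborFinset_eq_degree, h.degree_eq] at h2
    rw [card_univ] at h1
    omega
  simp only [mem_insert, SimpleGraph.mem_neighborFinset, not_or] at hy
  have hxy : x ≠ y := Ne.symm hy.1
  let e := (equivFinOfCardEq (h.card_common hxy hy.2)).symm
  have he : ∀ i, G.Adj x (e i) ∧ G.Adj y (e i) := fun i => by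
    have := (e i).2
    rwa [mem_inter, SimpleGraph.mem_neighborFinset, SimpleGraph.mem_neighborFinset] at this
  choose a ha _ using fun i => h.unique_triangle _ _ (he i).1
  choose b hb _ using fun i => h.unique_triangle _ _ (he i).2
  have hz : ∀ v, G.Adj x v → G.Adj y v → ∃ i, v = e i := fun v h1 h2 =>
    ⟨e.symm ⟨v, by simp [h1, h2]⟩, by simp⟩
  refine ⟨⟨x, y, fun i => e i, a, b, hxy, hy.2, Subtype.val_injective.comp e.injective,
    fun i => (he i).1, fun i => (he i).2, fun i => (ha i).1, fun i => (hb i).1,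
    fun i => (ha i).2, fun i => (hb i).2, ?_, ?_⟩⟩
  · intro v hv
    obtain ⟨w, hw, -⟩ := h.unique_triangle x v hv
    -- The triangle on `x` and `v` dominates `y`, so `v` or the third vertex is some `z i`.
    rcases h.adj_triangle hv hw.2 hw.1 y with h' | h' | h'
    · exact absurd h' hy.2
    · exact (hz v hv h'.symm).imp fun i hi => Or.inl hi
    · obtain ⟨i, rfl⟩ := hz w hw.1 h'.symm
      exact ⟨i, Or.inr (h.unique_triangle.eq hw.1 hv hw.2.symm (ha i).1 (ha i).2)⟩
  · intro v hv
    obtain ⟨w, hw, -⟩ := h.unique_triangle y v hv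
    rcases h.adj_triangle hv hw.2 hw.1 x with h' | h' | h'
    · exact absurd h'.symm hy.2
    · exact (hz v h'.symm hv).imp fun i hi => Or.inl hi
    · obtain ⟨i, rfl⟩ := hz w h'.symm hw.1
      exact ⟨i, Or.inr (h.unique_triangle.eq hw.1 hv hw.2.symm (hb i).1 (hb i).2)⟩

end

namespace QuadrangleFrame
variable {V : Type*} {G : SimpleGraph V} {t : ℕ} (F : QuadrangleFrame G t)

/-- The frame with the roles of `x` and `y` exchanged. -/
def swap : QuadrangleFrame G t where
  x := F.y
  y := F.x
  z := F.z
  a := F.b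
  b := F.a
  ne := F.ne.symm
  not_adj h := F.not_adj h.symm
  z_injective := F.z_injective
  adj_xz := F.adj_yz
  adj_yz := F.adj_xz
  adj_xa := F.adj_yb
  adj_yb := F.adj_xa
  adj_za := F.adj_zb
  adj_zb := F.adj_za
  of_adj_x := F.of_adj_y
  of_adj_y := F.of_adj_x

theorem not_adj_zz (h : EdgesInUniqueTriangle G) (i j : Fin (t + 1)) :
    ¬ G.Adj (F.z i) (F.z j) := fun hz =>
  F.ne (h.eq hz (F.adj_xz i).symm (F.adj_xz j).symm (F.adj_yz i).symm (F.adj_yz j).symm)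

theorem not_adj_ya (h : EdgesInUniqueTriangle G) (i : Fin (t + 1)) :
    ¬ G.Adj F.y (F.a i) := fun hy =>
  F.ne (h.eq (F.adj_za i) (F.adj_xz i).symm (F.adj_xa i).symm (F.adj_yz i).symm hy.symm)

theorem not_adj_xb (h : EdgesInUniqueTriangle G) (i : Fin (t + 1)) :
    ¬ G.Adj F.x (F.b i) := F.swap.not_adj_ya h i

theorem not_adj_aa (h : EdgesInUniqueTriangle G) (i j : Fin (t + 1)) :
    ¬ G.Adj (F.a i) (F.a j) := fun ha =>
  F.not_adj_ya h j (h.eq (F.adj_xa i) (F.adj_xz i) (F.adj_za i).symm (F.adj_xa j) ha ▸ F.adj_yz i)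

theorem not_adj_bb (h : EdgesInUniqueTriangle G) (i j : Fin (t + 1)) :
    ¬ G.Adj (F.b i) (F.b j) := F.swap.not_adj_aa h i j

theorem adj_za_iff (h : EdgesInUniqueTriangle G) (i j : Fin (t + 1)) :
    G.Adj (F.z i) (F.a j) ↔ i = j :=
  ⟨fun ha => F.z_injective
    (h.eq (F.adj_xa j) (F.adj_xz i) ha.symm (F.adj_xz j) (F.adj_za j).symm),
   fun e => e ▸ F.adj_za i⟩

theorem adj_zb_iff (h : EdgesInUniqueTriangle G) (i j : Fin (t + 1)) :
    G.Adj (F.z i) (F.b j) ↔ i = j := F.swap.adj_za_iff h i j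


/-- The points other than `x` and `y` adjacent neither to `x` nor to `y`. -/
def IsFar (w : V) : Prop := w ≠ F.x ∧ w ≠ F.y ∧ ¬ G.Adj F.x w ∧ ¬ G.Adj F.y w

/-- The indices `i` for which `w` is adjacent to `z i`. -/
def trace [DecidableRel G.Adj] (w : V) : Finset (Fin (t + 1)) := {i | G.Adj w (F.z i)}

theorem mem_trace [DecidableRel G.Adj] {w : V} {i : Fin (t + 1)} :
    i ∈ F.trace w ↔ G.Adj w (F.z i) := by simp [trace]

variable {F} in
theorem IsFar.swap {w : V} (hw : F.IsFar w) : F.swap.IsFar w :=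
  ⟨hw.2.1, hw.1, hw.2.2.2, hw.2.2.1⟩

variable {F} in
theorem card_trace_third [DecidableRel G.Adj] {w w' : V} {i : Fin (t + 1)} (hi : i ∈ F.trace w)
    (hS : F.trace w' = insert i (F.trace w)ᶜ) : #(F.trace w') + #(F.trace w) = t + 2 := by
  rw [hS, card_insert_of_notMem (by simpa using hi), card_compl, Fintype.card_fin]
  have := card_le_univ (F.trace w)
  rw [Fintype.card_fin] at this
  omega

section quadrangle
variable [Fintype V] [DecidableEq V] [DecidableRel G.Adj]

/-- For `i ≠ j` the triangle `y, z j, b j` dominates `a i`, which is adjacent neither to `y` nor to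
`z j`. -/
theorem adj_ab_iff (h : IsQuadrangleGraph G t) (i j : Fin (t + 1)) :
    G.Adj (F.a i) (F.b j) ↔ i ≠ j := by
  have hu := h.unique_triangle
  constructor
  · rintro hab rfl
    have := hu.eq (F.adj_za i) (F.adj_xz i).symm (F.adj_xa i).symm (F.adj_zb i) hab
    exact F.not_adj (this ▸ (F.adj_yb i).symm)
  · intro hij
    rcases h.adj_triangle (F.adj_yz j) (F.adj_zb j) (F.adj_yb j) (F.a i) with h' | h' | h'
    · exact absurd h' (F.not_adj_ya hu i)
    · exact absurd ((F.adj_za_iff hu j i).1 h').symm hij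
    · exact h'.symm

variable {F} {w w' : V}

theorem IsFar.adj_a_iff (hw : F.IsFar w) (h : IsQuadrangleGraph G t)
    (i : Fin (t + 1)) : G.Adj w (F.a i) ↔ i ∉ F.trace w := by
  rw [mem_trace]
  constructor
  · intro h1 h2
    exact hw.1 (h.unique_triangle.eq (F.adj_za i) h2.symm h1.symm (F.adj_xz i).symm
      (F.adj_xa i).symm)
  · intro h1
    rcases h.adj_triangle (F.adj_xz i) (F.adj_za i) (F.adj_xa i) w with h' | h' | h'
    · exact absurd h' hw.2.2.1
    · exact absurd h'.symm h1
    · exact h'.symm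

theorem IsFar.adj_b_iff (hw : F.IsFar w) (h : IsQuadrangleGraph G t)
    (i : Fin (t + 1)) : G.Adj w (F.b i) ↔ i ∉ F.trace w :=
  hw.swap.adj_a_iff h i

/-- The complement of a trace is never a singleton: the triangle on `w` and `a i` must contain a
neighbour of `y`, and this can only be some `b j` with `j ≠ i` outside the trace. -/
theorem IsFar.exists_ne_notMem_trace (hw : F.IsFar w) (h : IsQuadrangleGraph G t)
    {i : Fin (t + 1)} (hi : i ∉ F.trace w) :
    ∃ j, j ≠ i ∧ j ∉ F.trace w := by
  have hu := h.unique_triangle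
  have hwa := (hw.adj_a_iff h i).2 hi
  obtain ⟨u, hwu, -⟩ := hu _ _ hwa
  rcases h.adj_triangle hwa hwu.2 hwu.1 F.y with h' | h' | h'
  · exact absurd h'.symm hw.2.2.2
  · exact absurd h'.symm (F.not_adj_ya hu i)
  · obtain ⟨j, rfl | rfl⟩ := F.of_adj_y u h'.symm
    · have := (F.adj_za_iff hu j i).1 hwu.2.symm
      subst this
      exact absurd (F.mem_trace.2 hwu.1) hi
    · exact ⟨j, ((F.adj_ab_iff h i j).1 hwu.2).symm, (hw.adj_b_iff h j).1 hwu.1⟩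

theorem IsFar.card_trace_ne (hw : F.IsFar w) (h : IsQuadrangleGraph G t) : #(F.trace w) ≠ t := by
  intro hc
  have h1 : #(F.trace w)ᶜ = 1 := by rw [card_compl, hc, Fintype.card_fin]; omega
  obtain ⟨i, hi⟩ := card_eq_one.1 h1
  have hi' : ∀ j, j ∉ F.trace w ↔ j = i := fun j => by rw [← mem_compl, hi, mem_singleton]
  obtain ⟨j, hj, hj'⟩ := hw.exists_ne_notMem_trace h ((hi' i).2 rfl)
  exact hj ((hi' j).1 hj')

/-- The triangle `w, w', z i` dominates every other `z j`. As `z i` is not adjacent to `z j`,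
exactly one of `w`, `w'` is. -/
theorem IsFar.trace_third (hw : F.IsFar w) (h : IsQuadrangleGraph G t)
    {i : Fin (t + 1)} (hi : i ∈ F.trace w) (h1 : G.Adj w w')
    (h2 : G.Adj w' (F.z i)) : F.IsFar w' ∧ F.trace w' = insert i (F.trace w)ᶜ := by
  have hu := h.unique_triangle
  rw [mem_trace] at hi
  refine ⟨⟨?_, ?_, ?_, ?_⟩, ?_⟩
  · rintro rfl; exact hw.2.2.1 h1.symm
  · rintro rfl; exact hw.2.2.2 h1.symm
  · intro hx; exact hw.1 (hu.eq h2 h1.symm hi.symm hx.symm (F.adj_xz i).symm)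
  · intro hx; exact hw.2.1 (hu.eq h2 h1.symm hi.symm hx.symm (F.adj_yz i).symm)
  · ext j
    rw [mem_insert, mem_compl, mem_trace, mem_trace]
    constructor
    · intro hj
      by_cases hij : j = i
      · exact Or.inl hij
      · right
        intro hj'
        exact hij (F.z_injective (hu.eq h1 hj' hj hi h2))
    · rintro (rfl | hj)
      · exact h2
      · rcases h.adj_triangle h1 h2 hi (F.z j) with h' | h' | h'
        · exact absurd h' hj
        · exact h'
        · exact absurd h' (F.not_adj_zz hu i j)

theorem IsFar.exists_third (hw : F.IsFar w) (h : IsQuadrangleGraph G t)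
    {i : Fin (t + 1)} (hi : i ∈ F.trace w) :
    ∃ w', G.Adj w w' ∧ G.Adj w' (F.z i) ∧ F.IsFar w' ∧ F.trace w' = insert i (F.trace w)ᶜ := by
  obtain ⟨w', hw', -⟩ := h.unique_triangle _ _ (F.mem_trace.1 hi)
  exact ⟨w', hw'.1, hw'.2.symm, hw.trace_third h hi hw'.1 hw'.2.symm⟩

/-- Completing a triangle on `w` and some `z i` would give a far point with trace size `t`. -/
theorem IsFar.card_trace_ne_two (hw : F.IsFar w) (h : IsQuadrangleGraph G t) :
    #(F.trace w) ≠ 2 := by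
  intro hc
  obtain ⟨i, hi⟩ := card_pos.1 (by omega : 0 < #(F.trace w))
  obtain ⟨w', -, -, hw', hS⟩ := hw.exists_third h hi
  have := card_trace_third hi hS
  exact hw'.card_trace_ne h (by omega)

/-- The third vertex of the triangle on `w`, `w'` must be adjacent to both `x` and `y`, so it is
some `z i`. -/
theorem IsFar.exists_of_adj (hw : F.IsFar w) (h : IsQuadrangleGraph G t)
    (hw' : F.IsFar w') (hadj : G.Adj w w') :
    ∃ i ∈ F.trace w, F.trace w' = insert i (F.trace w)ᶜ := by
  have hu := h.unique_triangle
  obtain ⟨u, hwu, -⟩ := hu _ _ hadj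
  have hx : G.Adj F.x u := by
    rcases h.adj_triangle hadj hwu.2 hwu.1 F.x with h' | h' | h'
    · exact absurd h'.symm hw.2.2.1
    · exact absurd h'.symm hw'.2.2.1
    · exact h'.symm
  have hy : G.Adj F.y u := by
    rcases h.adj_triangle hadj hwu.2 hwu.1 F.y with h' | h' | h'
    · exact absurd h'.symm hw.2.2.2
    · exact absurd h'.symm hw'.2.2.2
    · exact h'.symm
  obtain ⟨i, rfl | rfl⟩ := F.of_adj_x u hx
  · have hi := F.mem_trace.2 hwu.1
    exact ⟨i, hi, (hw.trace_third h hi hadj hwu.2).2⟩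
  · exact absurd hy (F.not_adj_ya hu i)

end quadrangle

/-! ### Moments of the trace sizes and the possible parameters -/

section counting
variable [Fintype V] [DecidableEq V] [DecidableRel G.Adj]

/-- The set of points other than `x` and `y` adjacent neither to `x` nor to `y`. -/
def far : Finset V := ({F.x, F.y} ∪ (G.neighborFinset F.x ∪ G.neighborFinset F.y))ᶜ

theorem mem_far {w : V} : w ∈ F.far ↔ F.IsFar w := by
  simp only [far, IsFar, mem_compl, mem_union, mem_insert, mem_singleton,
    SimpleGraph.mem_neighborFinset]
  tauto

theorem card_far (h : IsQuadrangleGraph G t) : #F.far + 2 = 3 * t := by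
  have h1 : #({F.x, F.y} ∪ (G.neighborFinset F.x ∪ G.neighborFinset F.y)) =
      2 + #(G.neighborFinset F.x ∪ G.neighborFinset F.y) := by
    rw [card_union_of_disjoint, card_pair F.ne]
    simp [disjoint_left, F.not_adj, G.adj_comm F.y F.x]
  have h2 := card_union_add_card_inter (G.neighborFinset F.x) (G.neighborFinset F.y)
  rw [h.card_common F.ne F.not_adj, G.card_neighborFinset_eq_degree,
    G.card_neighborFinset_eq_degree, h.degree_eq, h.degree_eq] at h2
  have h3 := card_compl_add_card ({F.x, F.y} ∪ (G.neighborFinset F.x ∪ G.neighborFinset F.y))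
  rw [h.fintype_card] at h3
  rw [far]
  omega

/-- The four neighbours of `z i` that are not far are `x`, `y`, `a i`, `b i`. -/
theorem card_far_adj_z (h : IsQuadrangleGraph G t) (i : Fin (t + 1)) :
    #{w ∈ F.far | i ∈ F.trace w} + 4 = 2 * t + 2 := by
  have hu := h.unique_triangle
  have h1 : G.neighborFinset (F.z i) = {F.x, F.y, F.a i, F.b i} ∪ {w ∈ F.far | i ∈ F.trace w} := by
    ext w
    simp only [SimpleGraph.mem_neighborFinset, mem_union, mem_insert, mem_singleton, mem_filter,
      mem_far, mem_trace]
    constructor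
    · intro hw
      by_cases hwx : w = F.x
      · tauto
      by_cases hwy : w = F.y
      · tauto
      by_cases hx : G.Adj F.x w
      · have := hu.eq (F.adj_xz i) hx hw (F.adj_xa i) (F.adj_za i); tauto
      by_cases hy : G.Adj F.y w
      · have := hu.eq (F.adj_yz i) hy hw (F.adj_yb i) (F.adj_zb i); tauto
      exact Or.inr ⟨⟨hwx, hwy, hx, hy⟩, hw.symm⟩
    · rintro ((rfl | rfl | rfl | rfl) | hw)
      · exact (F.adj_xz i).symm
      · exact (F.adj_yz i).symm
      · exact F.adj_za i
      · exact F.adj_zb i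
      · exact hw.2.symm
  have hab : F.a i ≠ F.b i := fun e => F.not_adj_xb hu i (e ▸ F.adj_xa i)
  have h2 := h.degree_eq (F.z i)
  have hxb : F.x ≠ F.b i := fun e => F.not_adj (e ▸ (F.adj_yb i).symm)
  have hya : F.y ≠ F.a i := fun e => F.not_adj (e ▸ F.adj_xa i)
  rw [← G.card_neighborFinset_eq_degree, h1, card_union_of_disjoint,
    card_insert_of_notMem (by simp [F.ne, (F.adj_xa i).ne, hxb]),
    card_insert_of_notMem (by simp [hya, (F.adj_yb i).ne]), card_pair hab] at h2
  · omega
  · rw [disjoint_left]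
    simp only [mem_insert, mem_singleton, mem_filter, mem_far, IsFar]
    rintro w (rfl | rfl | rfl | rfl) ⟨⟨h1, h2, h3, h4⟩, -⟩
    · exact h1 rfl
    · exact h2 rfl
    · exact h3 (F.adj_xa i)
    · exact h4 (F.adj_yb i)

theorem card_far_adj_zz (h : IsQuadrangleGraph G t) {i j : Fin (t + 1)} (hij : i ≠ j) :
    #{w ∈ F.far | i ∈ F.trace w ∧ j ∈ F.trace w} + 2 = t + 1 := by
  have hu := h.unique_triangle
  have h1 : G.neighborFinset (F.z i) ∩ G.neighborFinset (F.z j) =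
      {F.x, F.y} ∪ {w ∈ F.far | i ∈ F.trace w ∧ j ∈ F.trace w} := by
    ext w
    simp only [SimpleGraph.mem_neighborFinset, mem_inter, mem_union, mem_insert, mem_singleton,
      mem_filter, mem_far, mem_trace]
    constructor
    · rintro ⟨hi, hj⟩
      by_cases hwx : w = F.x
      · tauto
      by_cases hwy : w = F.y
      · tauto
      by_cases hx : G.Adj F.x w
      · exact absurd (F.z_injective (hu.eq hx (F.adj_xz i) hi.symm (F.adj_xz j) hj.symm)) hij
      by_cases hy : G.Adj F.y w
      · exact absurd (F.z_injective (hu.eq hy (F.adj_yz i) hi.symm (F.adj_yz j) hj.symm)) hij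
      exact Or.inr ⟨⟨hwx, hwy, hx, hy⟩, hi.symm, hj.symm⟩
    · rintro ((rfl | rfl) | hw)
      · exact ⟨(F.adj_xz i).symm, (F.adj_xz j).symm⟩
      · exact ⟨(F.adj_yz i).symm, (F.adj_yz j).symm⟩
      · exact ⟨hw.2.1.symm, hw.2.2.symm⟩
  have h2 := h.card_common (F.z_injective.ne hij) (F.not_adj_zz hu i j)
  rw [h1, card_union_of_disjoint, card_pair F.ne] at h2
  · omega
  · rw [disjoint_left]
    simp only [mem_insert, mem_singleton, mem_filter, mem_far, IsFar]
    rintro w (rfl | rfl) ⟨⟨h1, h2, h3, h4⟩, -⟩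
    · exact h1 rfl
    · exact h2 rfl

theorem sum_card_trace (h : IsQuadrangleGraph G t) :
    (∑ w ∈ F.far, #(F.trace w) : ℤ) = 2 * (t ^ 2 - 1) := by
  have h1 : ∑ w ∈ F.far, #(F.trace w) = ∑ i, #{w ∈ F.far | i ∈ F.trace w} := by
    have := sum_card_bipartiteAbove_eq_sum_card_bipartiteBelow (s := F.far)
      (t := (univ : Finset (Fin (t + 1)))) (fun w i => i ∈ F.trace w)
    simpa [bipartiteAbove, bipartiteBelow] using this
  have h2 : ∀ i, (#{w ∈ F.far | i ∈ F.trace w} : ℤ) = 2 * t - 2 := fun i => by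
    have := F.card_far_adj_z h i; omega
  rw [← Nat.cast_sum, h1, Nat.cast_sum, sum_congr rfl fun i _ => h2 i, sum_const, card_univ,
    Fintype.card_fin, nsmul_eq_mul]
  push_cast; ring

/-- Ordered pairs of distinct `z i`, `z j` have `t + 1` common neighbours each, two of which are `x`
and `y`. -/
theorem sum_card_offDiag_trace (h : IsQuadrangleGraph G t) :
    (∑ w ∈ F.far, #(F.trace w).offDiag : ℤ) = (t + 1) * t * (t - 1) := by
  have h1 : ∑ w ∈ F.far, #(F.trace w).offDiag =
      ∑ p ∈ (univ : Finset (Fin (t + 1))).offDiag,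
        #{w ∈ F.far | p.1 ∈ F.trace w ∧ p.2 ∈ F.trace w} := by
    have := sum_card_bipartiteAbove_eq_sum_card_bipartiteBelow (s := F.far)
      (t := (univ : Finset (Fin (t + 1))).offDiag)
      (fun w p => p.1 ∈ F.trace w ∧ p.2 ∈ F.trace w)
    refine Eq.trans (sum_congr rfl fun w _ => ?_) this
    congr 1
    ext p
    simp [bipartiteAbove]; tauto
  have h2 : ∀ p ∈ (univ : Finset (Fin (t + 1))).offDiag,
      (#{w ∈ F.far | p.1 ∈ F.trace w ∧ p.2 ∈ F.trace w} : ℤ) = t - 1 := fun p hp => by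
    have := F.card_far_adj_zz h (mem_offDiag.1 hp).2.2; omega
  rw [← Nat.cast_sum, h1, Nat.cast_sum, sum_congr rfl h2, sum_const, offDiag_card, card_univ,
    Fintype.card_fin, nsmul_eq_mul, Nat.cast_sub (Nat.le_mul_self _)]
  push_cast; ring

theorem sum_sq_card_trace (h : IsQuadrangleGraph G t) :
    (∑ w ∈ F.far, (#(F.trace w) : ℤ) ^ 2) = (t ^ 2 - 1) * (t + 2) := by
  have h1 : ∀ w ∈ F.far, (#(F.trace w) : ℤ) ^ 2 = #(F.trace w).offDiag + #(F.trace w) := by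
    intro w _
    rw [offDiag_card, Nat.cast_sub (Nat.le_mul_self _)]
    push_cast; ring
  rw [sum_congr rfl h1, sum_add_distrib, F.sum_card_trace h, F.sum_card_offDiag_trace h]
  ring

theorem sum_quadratic (h : IsQuadrangleGraph G t) (p q : ℤ) :
    ∑ w ∈ F.far, (((#(F.trace w) : ℤ) - p) * ((#(F.trace w) : ℤ) - q)) =
      (t ^ 2 - 1) * (t + 2) - (p + q) * (2 * (t ^ 2 - 1)) + p * q * (3 * t - 2) := by
  have h1 : ∀ w ∈ F.far, ((#(F.trace w) : ℤ) - p) * ((#(F.trace w) : ℤ) - q) =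
      (#(F.trace w) : ℤ) ^ 2 - (p + q) * #(F.trace w) + p * q := fun w _ => by ring
  have h2 : (#F.far : ℤ) = 3 * t - 2 := by have := F.card_far h; omega
  rw [sum_congr rfl h1, sum_add_distrib, sum_sub_distrib, ← mul_sum, F.sum_card_trace h,
    F.sum_sq_card_trace h, sum_const, nsmul_eq_mul, h2]
  ring

/-- Cauchy–Schwarz on the first two moments reduces to `(t² - 1) t (t - 4) ≤ 0`. -/
theorem le_four (F : QuadrangleFrame G t) (h : IsQuadrangleGraph G t) : t ≤ 4 := by
  by_contra! ht
  have h1 := sq_sum_le_card_mul_sum_sq (s := F.far) (f := fun w => (#(F.trace w) : ℤ))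
  have h2 : (#F.far : ℤ) = 3 * t - 2 := by have := F.card_far h; omega
  rw [F.sum_card_trace h, F.sum_sq_card_trace h, h2] at h1
  have ht' : (5 : ℤ) ≤ t := by exact_mod_cast ht
  have h3 : 0 < ((t : ℤ) ^ 2 - 1) * (t * (t - 4)) :=
    mul_pos (by nlinarith) (mul_pos (by linarith) (by linarith))
  nlinarith

theorem ne_three (F : QuadrangleFrame G t) (h : IsQuadrangleGraph G t) : t ≠ 3 := by
  rintro rfl
  -- The sizes `2` and `3` are excluded, so every summand is nonnegative; yet the sum is `-12`.
  have h1 := F.sum_quadratic h 1 4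
  have h2 : 0 ≤ ∑ w ∈ F.far, (((#(F.trace w) : ℤ) - 1) * ((#(F.trace w) : ℤ) - 4)) := by
    refine sum_nonneg fun w hw => ?_
    rw [mem_far] at hw
    have h3 := hw.card_trace_ne h
    have h4 := hw.card_trace_ne_two h
    have : #(F.trace w) ≤ 1 ∨ 4 ≤ #(F.trace w) := by omega
    rcases this with h5 | h5
    · exact mul_nonneg_of_nonpos_of_nonpos (by omega) (by omega)
    · exact mul_nonneg (by omega) (by omega)
  rw [h1] at h2
  norm_num at h2

end counting

end QuadrangleFrame

theorem IsQuadrangleGraph.parameter {V : Type*} [Finite V] {G : SimpleGraph V} {t : ℕ}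
    (h : IsQuadrangleGraph G t) : t = 0 ∨ t = 1 ∨ t = 2 ∨ t = 4 := by
  classical
  have := Fintype.ofFinite V
  rcases Nat.eq_zero_or_pos t with rfl | ht
  · simp
  obtain ⟨F⟩ := h.exists_frame ht
  have h1 := F.le_four h
  have h2 := F.ne_three h
  omega

/-! ### Coordinates and uniqueness -/

/-- The traces of the far points in a quadrangle graph with parameter `t ∈ {1, 2, 4}`. -/
def possibleTraces (t : ℕ) : Finset (Finset (Fin (t + 1))) :=
  {S | if t = 1 then #S = 0 else if t = 2 then #S = 1 ∨ #S = 3 else #S = 3}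

/-- Names for the vertices of a quadrangle graph: `x` and `y`, then `z i`, `a i` and `b i`, then
the far points, named by their traces. -/
abbrev QuadrangleCode (t : ℕ) : Type :=
  Bool ⊕ (Fin (t + 1) ⊕ Fin (t + 1) ⊕ Fin (t + 1)) ⊕ {S // S ∈ possibleTraces t}

namespace QuadrangleCode
variable {t : ℕ}

/-- Adjacency of vertices in terms of their names. -/
def Adj : QuadrangleCode t → QuadrangleCode t → Prop
  | .inl _, .inl _ => False
  | .inl _, .inr (.inl (.inl _)) => True
  | .inl c, .inr (.inl (.inr (.inl _))) => c = true
  | .inl c, .inr (.inl (.inr (.inr _))) => c = false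
  | .inl _, .inr (.inr _) => False
  | .inr (.inl (.inl _)), .inl _ => True
  | .inr (.inl (.inl _)), .inr (.inl (.inl _)) => False
  | .inr (.inl (.inl i)), .inr (.inl (.inr (.inl j))) => i = j
  | .inr (.inl (.inl i)), .inr (.inl (.inr (.inr j))) => i = j
  | .inr (.inl (.inl i)), .inr (.inr S) => i ∈ S.1
  | .inr (.inl (.inr (.inl _))), .inl c => c = true
  | .inr (.inl (.inr (.inl i))), .inr (.inl (.inl j)) => i = j
  | .inr (.inl (.inr (.inl _))), .inr (.inl (.inr (.inl _))) => False
  | .inr (.inl (.inr (.inl i))), .inr (.inl (.inr (.inr j))) => i ≠ j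
  | .inr (.inl (.inr (.inl i))), .inr (.inr S) => i ∉ S.1
  | .inr (.inl (.inr (.inr _))), .inl c => c = false
  | .inr (.inl (.inr (.inr i))), .inr (.inl (.inl j)) => i = j
  | .inr (.inl (.inr (.inr i))), .inr (.inl (.inr (.inl j))) => i ≠ j
  | .inr (.inl (.inr (.inr _))), .inr (.inl (.inr (.inr _))) => False
  | .inr (.inl (.inr (.inr i))), .inr (.inr S) => i ∉ S.1
  | .inr (.inr _), .inl _ => False
  | .inr (.inr S), .inr (.inl (.inl i)) => i ∈ S.1
  | .inr (.inr S), .inr (.inl (.inr (.inl i))) => i ∉ S.1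
  | .inr (.inr S), .inr (.inl (.inr (.inr i))) => i ∉ S.1
  | .inr (.inr S), .inr (.inr T) => ∃ i ∈ S.1, T.1 = insert i S.1ᶜ

end QuadrangleCode

namespace QuadrangleFrame
variable {V : Type*} {G : SimpleGraph V} {t : ℕ} (F : QuadrangleFrame G t) [Fintype V]
  [DecidableEq V] [DecidableRel G.Adj]

theorem trace_mem_possibleTraces (h : IsQuadrangleGraph G t) (ht : t = 1 ∨ t = 2 ∨ t = 4) {w : V}
    (hw : F.IsFar w) :
    F.trace w ∈ possibleTraces t := by
  -- A vanishing sum of nonnegative terms forces each size to be a root. The roots are `0, 0` for `t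
  -- = 1`, `1, 3` for `t = 2` (size `2` being excluded) and `3, 3` for `t = 4`.
  have key : ∀ p q : ℤ, (∀ w ∈ F.far,
      0 ≤ ((#(F.trace w) : ℤ) - p) * ((#(F.trace w) : ℤ) - q)) →
      ((t : ℤ) ^ 2 - 1) * (t + 2) - (p + q) * (2 * (t ^ 2 - 1)) + p * q * (3 * t - 2) = 0 →
      (#(F.trace w) : ℤ) = p ∨ (#(F.trace w) : ℤ) = q := by
    intro p q h0 h1
    have h2 := (sum_eq_zero_iff_of_nonneg h0).1 ((F.sum_quadratic h p q).trans h1) w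
      (F.mem_far.2 hw)
    rcases mul_eq_zero.1 h2 with h3 | h3
    · left; omega
    · right; omega
  rw [possibleTraces, mem_filter]
  refine ⟨mem_univ _, ?_⟩
  rcases ht with rfl | rfl | rfl
  · have := key 0 0 (fun w _ => mul_self_nonneg _) (by norm_num)
    simp only [if_true]
    omega
  · have := key 1 3 (fun w hw => ?_) (by norm_num)
    · norm_num
      omega
    · rw [mem_far] at hw
      have h3 := hw.card_trace_ne_two h
      have : #(F.trace w) ≤ 1 ∨ 3 ≤ #(F.trace w) := by omega
      rcases this with h5 | h5
      · exact mul_nonneg_of_nonpos_of_nonpos (by omega) (by omega)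
      · exact mul_nonneg (by omega) (by omega)
  · have := key 3 3 (fun w _ => mul_self_nonneg _) (by norm_num)
    norm_num
    omega

theorem trace_injOn (h : IsQuadrangleGraph G t) (ht : t = 1 ∨ t = 2 ∨ t = 4) :
    Set.InjOn F.trace F.far := by
  have hu := h.unique_triangle
  intro w hw w' hw' heq
  rw [mem_coe] at hw hw'
  have hm := F.trace_mem_possibleTraces h ht (F.mem_far.1 hw)
  rw [possibleTraces, mem_filter] at hm
  replace hm := hm.2
  rcases ht with rfl | rfl | rfl
  · have := F.card_far h
    exact card_le_one.1 (by omega : #F.far ≤ 1) w hw w' hw'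
  · have huniv : #{w ∈ F.far | #(F.trace w) = 3} ≤ 1 := by
      have h1 : (∑ w ∈ F.far, #(F.trace w).offDiag : ℤ) = 6 := by
        rw [F.sum_card_offDiag_trace h]; norm_num
      rw [← Nat.cast_sum] at h1
      have h2 : ∑ w ∈ F.far with #(F.trace w) = 3, #(F.trace w).offDiag ≤
          ∑ w ∈ F.far, #(F.trace w).offDiag := sum_le_sum_of_subset (filter_subset _ _)
      have h3 : ∑ w ∈ F.far with #(F.trace w) = 3, #(F.trace w).offDiag =
          ∑ w ∈ F.far with #(F.trace w) = 3, 6 :=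
        sum_congr rfl fun w hw => by rw [offDiag_card, (mem_filter.1 hw).2]
      rw [h3, sum_const, smul_eq_mul] at h2
      omega
    norm_num at hm
    rcases hm with hm | hm
    · obtain ⟨i, hi⟩ := card_pos.1 (by omega : 0 < #(F.trace w))
      obtain ⟨u, h1, h2, h3, h4⟩ := (F.mem_far.1 hw).exists_third h hi
      obtain ⟨u', h1', h2', h3', h4'⟩ := (F.mem_far.1 hw').exists_third h (heq ▸ hi)
      have hc := card_trace_third hi h4
      have hc' := card_trace_third (F := F) (w := w') (heq ▸ hi) h4'
      rw [← heq] at hc'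
      have : u = u' := card_le_one.1 huniv u
        (mem_filter.2 ⟨F.mem_far.2 h3, by omega⟩) u' (mem_filter.2 ⟨F.mem_far.2 h3', by omega⟩)
      subst this
      exact hu.eq h2 h1.symm (F.mem_trace.1 hi).symm h1'.symm (F.mem_trace.1 (heq ▸ hi)).symm
    · exact card_le_one.1 huniv w (mem_filter.2 ⟨hw, hm⟩) w'
        (mem_filter.2 ⟨hw', by rw [← heq]; exact hm⟩)
  · norm_num at hm
    have hc : #(F.trace w)ᶜ = 2 := by rw [card_compl, hm, Fintype.card_fin]
    -- For `t = 4` the two missing indices give an edge from `a i` to `b j`, whose triangle has `w`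
    -- as third vertex.
    obtain ⟨i, j, hij, hS⟩ := card_eq_two.1 hc
    have hi : i ∉ F.trace w := by rw [← mem_compl, hS]; simp
    have hj : j ∉ F.trace w := by rw [← mem_compl, hS]; simp
    have hi' := heq ▸ hi
    have hj' := heq ▸ hj
    rw [mem_far] at hw hw'
    exact hu.eq ((F.adj_ab_iff h i j).2 hij) ((hw.adj_a_iff h i).2 hi).symm
      ((hw.adj_b_iff h j).2 hj).symm ((hw'.adj_a_iff h i).2 hi').symm
      ((hw'.adj_b_iff h j).2 hj').symm

/-- Traces are distinct and admissible, and there are as many admissible sets (`1`, `4`, `10`) as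
far points. -/
theorem exists_far_of_mem_possibleTraces (h : IsQuadrangleGraph G t) (ht : t = 1 ∨ t = 2 ∨ t = 4)
    (S : {S // S ∈ possibleTraces t}) : ∃ w, F.IsFar w ∧ F.trace w = S.1 := by
  have hcard : #(possibleTraces t) + 2 = 3 * t := by rcases ht with rfl | rfl | rfl <;> decide
  have himg : F.far.image F.trace = possibleTraces t := by
    apply eq_of_subset_of_card_le
    · intro S hS
      obtain ⟨w, hw, rfl⟩ := mem_image.1 hS
      exact F.trace_mem_possibleTraces h ht (F.mem_far.1 hw)
    · rw [card_image_of_injOn (F.trace_injOn h ht)]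
      have := F.card_far h
      omega
  obtain ⟨w, hw, hS⟩ := mem_image.1 (himg.symm ▸ S.2 : S.1 ∈ F.far.image F.trace)
  exact ⟨w, F.mem_far.1 hw, hS⟩

end QuadrangleFrame

theorem IsQuadrangleGraph.exists_coordinates {V : Type*} {G : SimpleGraph V} {t : ℕ} [Fintype V]
    [DecidableEq V] [DecidableRel G.Adj] (h : IsQuadrangleGraph G t)
    (ht : t = 1 ∨ t = 2 ∨ t = 4) :
    ∃ e : QuadrangleCode t ≃ V, ∀ c d, G.Adj (e c) (e d) ↔ c.Adj d := by
  obtain ⟨F⟩ := h.exists_frame (by omega)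
  have hu := h.unique_triangle
  choose f hf hS using F.exists_far_of_mem_possibleTraces h ht
  let e : QuadrangleCode t → V := Sum.elim (fun c => if c then F.x else F.y)
    (Sum.elim (Sum.elim F.z (Sum.elim F.a F.b)) f)
  have hsurj : Function.Surjective e := by
    intro v
    by_cases hx : v = F.x
    · exact ⟨.inl true, hx.symm⟩
    by_cases hy : v = F.y
    · exact ⟨.inl false, hy.symm⟩
    by_cases hvx : G.Adj F.x v
    · obtain ⟨i, rfl | rfl⟩ := F.of_adj_x v hvx
      · exact ⟨.inr (.inl (.inl i)), rfl⟩
      · exact ⟨.inr (.inl (.inr (.inl i))), rfl⟩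
    by_cases hvy : G.Adj F.y v
    · obtain ⟨i, rfl | rfl⟩ := F.of_adj_y v hvy
      · exact ⟨.inr (.inl (.inl i)), rfl⟩
      · exact ⟨.inr (.inl (.inr (.inr i))), rfl⟩
    have hv : F.IsFar v := ⟨hx, hy, hvx, hvy⟩
    let S : {S // S ∈ possibleTraces t} := ⟨F.trace v, F.trace_mem_possibleTraces h ht hv⟩
    exact ⟨.inr (.inr S), F.trace_injOn h ht (F.mem_far.2 (hf S)) (F.mem_far.2 hv) (hS S)⟩
  have hcard : Fintype.card (QuadrangleCode t) = Fintype.card V := by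
    have : #(possibleTraces t) + 2 = 3 * t := by rcases ht with rfl | rfl | rfl <;> decide
    rw [h.fintype_card]
    simp only [Fintype.card_sum, Fintype.card_bool, Fintype.card_fin, Fintype.card_coe]
    omega
  refine ⟨Equiv.ofBijective e ((Fintype.bijective_iff_surjective_and_card e).2 ⟨hsurj, hcard⟩), ?_⟩
  have hfar : ∀ S T, G.Adj (f S) (f T) ↔ ∃ i ∈ S.1, T.1 = insert i S.1ᶜ := by
    intro S T
    constructor
    · intro hadj
      have := (hf S).exists_of_adj h (hf T) hadj
      rwa [hS, hS] at this
    -- The third point on `f S` and `z i` has trace `T`, so it is `f T` by injectivity.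
    · rintro ⟨i, hi, hT⟩
      obtain ⟨w, h1, -, h3, h4⟩ := (hf S).exists_third h (by rwa [hS] : i ∈ F.trace (f S))
      rw [hS, ← hT, ← hS T] at h4
      rwa [← F.trace_injOn h ht (F.mem_far.2 h3) (F.mem_far.2 (hf T)) h4]
  have hz : ∀ S i, G.Adj (f S) (F.z i) ↔ i ∈ S.1 := fun S i => by rw [← F.mem_trace, hS]
  have ha : ∀ S i, G.Adj (f S) (F.a i) ↔ i ∉ S.1 := fun S i => by rw [(hf S).adj_a_iff h, hS]
  have hb : ∀ S i, G.Adj (f S) (F.b i) ↔ i ∉ S.1 := fun S i => by rw [(hf S).adj_b_iff h, hS]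
  change ∀ c d, G.Adj (e c) (e d) ↔ c.Adj d
  have hxw := fun S => (hf S).2.2.1
  have hyw := fun S => (hf S).2.2.2
  rintro ((_ | _) | (i | i | i) | S) ((_ | _) | (j | j | j) | T) <;>
    simp only [e, Sum.elim_inl, Sum.elim_inr, QuadrangleCode.Adj, if_true, Bool.false_eq_true,
      if_false, iff_true, iff_false, SimpleGraph.irrefl, reduceCtorEq]
  -- The frame lemmas cover one orientation of each pair; the second alternative handles the
  -- reversed one.
  all_goals first
    | simp only [F.not_adj, F.adj_xz, F.adj_yz, F.adj_xa, F.adj_yb, F.not_adj_zz hu, hxw, hyw,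
        F.not_adj_ya hu, F.not_adj_xb hu, F.not_adj_aa hu, F.not_adj_bb hu, F.adj_za_iff hu,
        F.adj_zb_iff hu, F.adj_ab_iff h, hfar, hz, ha, hb, not_false_eq_true]
    | rw [G.adj_comm]
      simp only [F.not_adj, F.adj_xz, F.adj_yz, F.adj_xa, F.adj_yb, hxw, hyw,
        F.not_adj_ya hu, F.not_adj_xb hu, F.adj_za_iff hu, F.adj_zb_iff hu, F.adj_ab_iff h,
        hz, ha, hb, not_false_eq_true, eq_comm, ne_comm]

theorem IsQuadrangleGraph.exists_iso {V : Type*} [Finite V] {G H : SimpleGraph V} {t : ℕ}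
    (hG : IsQuadrangleGraph G t) (hH : IsQuadrangleGraph H t) : Nonempty (G ≃g H) := by
  classical
  have := Fintype.ofFinite V
  rcases Nat.eq_zero_or_pos t with rfl | ht
  · rw [hG.eq_top, hH.eq_top]
    exact ⟨SimpleGraph.Iso.refl⟩
  · have ht' : t = 1 ∨ t = 2 ∨ t = 4 := by have := hG.parameter; omega
    obtain ⟨e, he⟩ := hG.exists_coordinates ht'
    obtain ⟨f, hf⟩ := hH.exists_coordinates ht'
    refine ⟨⟨e.symm.trans f, fun {v w} => ?_⟩⟩
    obtain ⟨c, rfl⟩ := e.surjective v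
    obtain ⟨d, rfl⟩ := e.surjective w
    rw [he, Equiv.trans_apply, Equiv.trans_apply, e.symm_apply_apply, e.symm_apply_apply, hf]

theorem mainTheorem3 (n : ℕ) (hn : 3 ≤ n) :
    ((∃ 𝒜 : Finset (Finset (Fin n)), IsExtremalTwoThreeAntichain 𝒜) ↔
      n ∈ ({3, 9, 15, 27} : Set ℕ)) ∧
    (∀ 𝒜 ℬ : Finset (Finset (Fin n)), IsExtremalTwoThreeAntichain 𝒜 →
      IsExtremalTwoThreeAntichain ℬ → FamilyIsomorphic 𝒜 ℬ) ∧
    (∀ 𝒜 : Finset (Finset (Fin n)), IsExtremalTwoThreeAntichain 𝒜 →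
      EdgesInUniqueTriangle (antichainGraph 𝒜) ∧
      ((antichainGraph 𝒜).edgeSet.ncard : ℚ) = (n : ℚ) * ((n : ℚ) + 3) / 6) ∧
    (∀ G : SimpleGraph (Fin n),
      (EdgesInUniqueTriangle G ∧ (G.edgeSet.ncard : ℚ) = (n : ℚ) * ((n : ℚ) + 3) / 6) ↔
      ((n = 3 ∧ G = ⊤) ∨
        ∃ t : ℕ, n = 6 * t + 3 ∧ ∃ (P L : Type) (I : P → L → Prop),
          IsGeneralizedQuadrangle I 2 t ∧ Nonempty (G ≃g collinearityGraph I))) := by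
  classical
  refine ⟨⟨?_, ?_⟩, ?_, ?_, ?_⟩
  · rintro ⟨𝒜, h𝒜⟩
    obtain ⟨t, ht⟩ := h𝒜.isQuadrangleGraph hn
    have hnt : n = 6 * t + 3 := by simpa using ht.card_verts
    rcases ht.parameter with rfl | rfl | rfl | rfl <;> simp [hnt]
  · intro hmem
    obtain ⟨t, ht, hnt⟩ : ∃ t, (t = 0 ∨ t = 1 ∨ t = 2 ∨ t = 4) ∧ n = 6 * t + 3 := by
      simp only [Set.mem_insert_iff, Set.mem_singleton_iff] at hmem
      rcases hmem with rfl | rfl | rfl | rfl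
      · exact ⟨0, by simp⟩
      · exact ⟨1, by simp⟩
      · exact ⟨2, by simp⟩
      · exact ⟨4, by simp⟩
    obtain ⟨H, hH⟩ := exists_isQuadrangleGraph ht hnt
    exact ⟨_, hH.isExtremal⟩
  · intro 𝒜 ℬ hA hB
    obtain ⟨t, ht⟩ := hA.isQuadrangleGraph hn
    obtain ⟨s, hs⟩ := hB.isQuadrangleGraph hn
    obtain rfl : t = s := by
      have h1 := ht.card_verts
      have h2 := hs.card_verts
      omega
    obtain ⟨e⟩ := ht.exists_iso hs
    exact familyIsomorphic_of_iso hA.1 hB.1 e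
  · intro 𝒜 hA
    exact (isQuadrangleGraph_iff_ncard_edgeSet hn _).2 (hA.isQuadrangleGraph hn)
  · intro G
    rw [isQuadrangleGraph_iff_ncard_edgeSet hn, exists_isQuadrangleGraph_iff]
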